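/- Let $D=[0,1]\times[0,1]$. An open partial braid graph $\Gamma$ consists of finitely many smooth arcs $\gamma_1,\dots,\gamma_n:[0,1]\to D$ and a finite set $W\subset D$ of vertices such that: the second coordinate of each $\gamma_i$ has positive derivative on all of $[0,1]$; every vertex lies in the interior of one or two arcs; any two arcs intersect transversely and only in their interiors, and every intersection point of two arcs belongs to $W$; no three arcs have a common point; and the number $k$ of arcs with initial point on the bottom edge $[0,1]\times\{0\}$ equals the number of arcs with final point on the top edge $[0,1]\times\{1\}$. The braid closure $\hat\Gamma$ is obtained by joining, for $j=1,\dots,k$, the $j$-th end point from the left on the top edge to the $j$-th end point from the left on the bottom edge by a strand, and erasing the $2k$ univalent vertices so joined. The remaining end points of arcs are called loose ends. Thus $\hat\Gamma$ is an oriented graph with vertex set $W$ (each vertex being two-valent or four-valent, according to whether one or two arcs pass through it) and loose ends. Let $E$ be its set of edges and $\mathcal R=\mathbb Z[U_e \mid e\in E]$. For a four-valent vertex $p$ with outgoing edges $a,b$ and incoming edges $c,d$, put $L(p)=U_a+U_b-U_c-U_d$ and $Q(p)=U_aU_b-U_cU_d$. For a two-valent vertex $p$ with outgoing edge $e$ and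 incoming edge $f$, put $Q(p)=U_e-U_f$. Let $L\subset\mathcal R$ be the ideal generated by the $L(p)$ for all four-valent $p$, and $Q\subset\mathcal R$ the ideal generated by the $Q(p)$ for all $p\in W$. Assume that $\hat\Gamma$ is connected and has at least one loose end. Then $$\operatorname{Tor}^{\mathcal R}_i(\mathcal R/L,\mathcal R/Q)=0\quad\text{for all } i>k.$$ -/

import Mathlib

open scoped ContDiff
open Set CategoryTheory

/-- An open partial braid graph in the square `D = [0,1] × [0,1]`: finitely many smooth arcs with
strictly increasing height, and finitely many vertices. The arcs are functions on `ℝ` of which only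
the restrictions to `[0,1]` matter. -/
structure OpenPartialBraidGraph where
  /-- the number of arcs -/
  n : ℕ
  /-- the arcs -/
  arc : Fin n → ℝ → ℝ × ℝ
  /-- the vertices -/
  W : Finset (ℝ × ℝ)
  smooth : ∀ i, ContDiffOn ℝ ∞ (arc i) (Icc 0 1)
  mem_square : ∀ i, ∀ t ∈ Icc (0 : ℝ) 1, arc i t ∈ Icc (0 : ℝ) 1 ×ˢ Icc (0 : ℝ) 1
  deriv_pos : ∀ i, ∀ t ∈ Icc (0 : ℝ) 1, 0 < derivWithin (fun s => (arc i s).2) (Icc 0 1) t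
  /-- every vertex lies in the interior of some arc -/
  vertex_mem : ∀ w ∈ W, ∃ i, ∃ t ∈ Ioo (0 : ℝ) 1, arc i t = w
  /-- two arcs meet only in their interiors ... -/
  meet_interior : ∀ i j, i ≠ j → ∀ s ∈ Icc (0 : ℝ) 1, ∀ t ∈ Icc (0 : ℝ) 1, arc i s = arc j t →
    s ∈ Ioo (0 : ℝ) 1 ∧ t ∈ Ioo (0 : ℝ) 1
  /-- ... transversely ... -/
  meet_transverse : ∀ i j, i ≠ j → ∀ s ∈ Icc (0 : ℝ) 1, ∀ t ∈ Icc (0 : ℝ) 1, arc i s = arc j t →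
    LinearIndependent ℝ ![derivWithin (arc i) (Icc 0 1) s, derivWithin (arc j) (Icc 0 1) t]
  /-- ... and only in vertices -/
  meet_vertex : ∀ i j, i ≠ j → ∀ s ∈ Icc (0 : ℝ) 1, ∀ t ∈ Icc (0 : ℝ) 1, arc i s = arc j t →
    arc i s ∈ W
  /-- no three arcs have a common point -/
  no_triple : ∀ i j l, i ≠ j → i ≠ l → j ≠ l →
    arc i '' Icc 0 1 ∩ arc j '' Icc 0 1 ∩ arc l '' Icc 0 1 = ∅
  /-- as many arcs start on the bottom edge of `D` as end on its top edge -/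
  card_bottom_eq_top : {i | (arc i 0).2 = 0}.ncard = {i | (arc i 1).2 = 1}.ncard

namespace OpenPartialBraidGraph

variable (Γ : OpenPartialBraidGraph)

/-- The number `k` of strands that close up `Γ`. -/
noncomputable def numStrands : ℕ := {i | (Γ.arc i 0).2 = 0}.ncard

/-- The edges of `Γ`: the pieces `[lo, hi]` into which the vertices cut the arcs, oriented
upwards. -/
structure Segment where
  /-- the arc that contains the segment -/
  idx : Fin Γ.n
  lo : ℝ
  hi : ℝ
  zero_le_lo : 0 ≤ lo
  lo_lt_hi : lo < hi
  hi_le_one : hi ≤ 1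
  lo_end : lo = 0 ∨ Γ.arc idx lo ∈ Γ.W
  hi_end : hi = 1 ∨ Γ.arc idx hi ∈ Γ.W
  no_vertex : ∀ t ∈ Ioo lo hi, Γ.arc idx t ∉ Γ.W

variable {Γ} in
/-- The initial point of a segment. -/
def Segment.initial (e : Γ.Segment) : ℝ × ℝ := Γ.arc e.idx e.lo

variable {Γ} in
/-- The final point of a segment. -/
def Segment.final (e : Γ.Segment) : ℝ × ℝ := Γ.arc e.idx e.hi

/-- The number of univalent vertices on the bottom edge of `D` that lie to the left of `x`. -/
noncomputable def bottomRank (x : ℝ) : ℕ := {i | (Γ.arc i 0).2 = 0 ∧ (Γ.arc i 0).1 < x}.ncard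

/-- The number of univalent vertices on the top edge of `D` that lie to the left of `x`. -/
noncomputable def topRank (x : ℝ) : ℕ := {i | (Γ.arc i 1).2 = 1 ∧ (Γ.arc i 1).1 < x}.ncard

variable {Γ} in
/-- A strand of the braid closure leads from the final point of `e` to the initial point of `f`:
the first is on the top edge of `D`, the second on the bottom edge, and they have the same position
when these points are counted from the left (the strands run around on the right, nested without
crossings). -/
def Segment.Joined (e f : Γ.Segment) : Prop :=
  e.hi = 1 ∧ e.final.2 = 1 ∧ f.lo = 0 ∧ f.initial.2 = 0 ∧
    Γ.topRank e.final.1 = Γ.bottomRank f.initial.1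

/-- The set `E` of edges of the braid closure: segments are merged along the strands. -/
def Edge : Type := Quot (Segment.Joined (Γ := Γ))

variable {Γ} in
/-- The edge of the braid closure that contains a given segment. -/
def Segment.edge (e : Γ.Segment) : Γ.Edge := Quot.mk _ e

/-- Two distinct edges of the braid closure are adjacent when they have a common endpoint in `W`. -/
def edgeGraph : SimpleGraph Γ.Edge :=
  SimpleGraph.fromRel fun x y => ∃ e f : Γ.Segment, e.edge = x ∧ f.edge = y ∧
    ∃ p ∈ Γ.W, (e.initial = p ∨ e.final = p) ∧ (f.initial = p ∨ f.final = p)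

/-- The braid closure is connected: it is not empty, and any two of its edges are linked by a
chain of edges in which successive ones share a vertex (each vertex lies on an edge). -/
def ConnectedClosure : Prop := Γ.edgeGraph.Connected

/-- The loose ends of the braid closure: the ends of arcs that are not joined by strands. -/
def looseEnds : Set (ℝ × ℝ) :=
  {x | ∃ i, (x = Γ.arc i 0 ∧ x.2 ≠ 0) ∨ (x = Γ.arc i 1 ∧ x.2 ≠ 1)}

/-- Four-valent vertices (crossings): vertices through which two arcs pass. -/
def IsFourValent (p : ℝ × ℝ) : Prop :=
  p ∈ Γ.W ∧ ∃ i j, i ≠ j ∧ p ∈ Γ.arc i '' Icc 0 1 ∧ p ∈ Γ.arc j '' Icc 0 1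

/-- Two-valent vertices: vertices through which exactly one arc passes. -/
def IsTwoValent (p : ℝ × ℝ) : Prop :=
  p ∈ Γ.W ∧ ∃! i, p ∈ Γ.arc i '' Icc 0 1

/-- The ring `ℤ[U_e | e ∈ E]`. -/
abbrev EdgeRing : Type := MvPolynomial Γ.Edge ℤ

variable {Γ} in
/-- The variable of the edge that contains a given segment. -/
noncomputable def Segment.U (e : Γ.Segment) : Γ.EdgeRing := MvPolynomial.X e.edge

/-- The ideal `L`, generated by `L(p) = U_a + U_b - U_c - U_d` for the four-valent vertices `p`,
where `a`, `b` are the two outgoing edges and `c`, `d` the two incoming edges at `p`. -/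
noncomputable def idealL : Ideal Γ.EdgeRing :=
  Ideal.span {x | ∃ p, Γ.IsFourValent p ∧ ∃ a b c d : Γ.Segment, a ≠ b ∧ c ≠ d ∧
    a.initial = p ∧ b.initial = p ∧ c.final = p ∧ d.final = p ∧ x = a.U + b.U - c.U - d.U}

/-- The ideal `Q`, generated by `Q(p) = U_a U_b - U_c U_d` for the four-valent vertices `p`,
and by `Q(p) = U_e - U_f` for the two-valent vertices `p`, where `e` is the outgoing edge and
`f` the incoming edge at `p`. -/
noncomputable def idealQ : Ideal Γ.EdgeRing :=
  Ideal.span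
    ({x | ∃ p, Γ.IsFourValent p ∧ ∃ a b c d : Γ.Segment, a ≠ b ∧ c ≠ d ∧
        a.initial = p ∧ b.initial = p ∧ c.final = p ∧ d.final = p ∧ x = a.U * b.U - c.U * d.U} ∪
      {x | ∃ p, Γ.IsTwoValent p ∧ ∃ e f : Γ.Segment,
        e.initial = p ∧ f.final = p ∧ x = e.U - f.U})

end OpenPartialBraidGraph

/-! Cut the closure open along its strands. Let R' be the polynomial ring on the segments, so that R
is R' modulo one difference X_t - X_s per strand, and let L' ⊂ R' be the ideal of the linear
relations before gluing. Let P be the polynomial ring over ℤ with one variable per vertex, mapped to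
R' and to R by sending the variable of p to Q(p). If R is flat over P, then R/Q = R ⊗_P ℤ and
Tor^R(R/L, R/Q) = Tor^P(R/L, ℤ) (`isZero_tor_of_exactAbove`). Moreover R/L is R'/L' modulo the
strand differences. If R'/L' is flat over P and the differences form a regular sequence on it, then
each of these at most k quotients by a nonzerodivisor raises the last degree in which Tor can
survive by at most one. This gives the bound k.

Both flatness statements come from leading terms: polynomials whose leading monomials have pairwise
disjoint variables make the polynomial ring free over the polynomial ring that they parametrize
(`free_of_hasLeadingTerm`). For R'/L' the weight is a height along the open graph. For R the height
fails, since the closure has cycles; instead the weight is an integer function on the segments with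
net flow 1 at every vertex and strand, so that outgoing monomials dominate incoming ones.

Flows also give the regular sequence (`mem_of_gluing_mul_mem`): translating the variables along a
flow concentrated at one strand preserves L' and the other differences, but shifts that one
difference by a free parameter.

Flows with arbitrary prescribed net flow exist because the closure is connected and has a loose end
(`flowGroup_eq_top`): surplus at a node can be pushed along edges to the loose end, where it leaves
the graph. -/

open TensorProduct

/-! ### Tor, flat base change and quotients by nonzerodivisors -/

/-- Extension of scalars along `algebraMap P R`, as a functor on module categories. -/
noncomputable def baseChangeFunctor (P R : Type) [CommRing P] [CommRing R] [Algebra P R] :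
    ModuleCat.{0} P ⥤ ModuleCat.{0} R where
  obj M := ModuleCat.of R (R ⊗[P] M)
  map f := ModuleCat.ofHom (f.hom.baseChange R)
  map_id M := by
    ext x
    simp
  map_comp f g := by
    ext x
    simp [LinearMap.baseChange_comp]

section BaseChange

variable (P R : Type) [CommRing P] [CommRing R] [Algebra P R]

instance baseChangeFunctor_additive : (baseChangeFunctor P R).Additive where
  map_add {M N f g} := by
    ext x
    simp only [baseChangeFunctor, ModuleCat.hom_add, LinearMap.baseChange_add]
    rfl

instance baseChangeFunctor_preservesProjectiveObjects :
    (baseChangeFunctor P R).PreservesProjectiveObjects where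
  projective_obj {M} hM := by
    have : Module.Projective P M := (IsProjective.iff_projective M).2 hM
    exact (IsProjective.iff_projective (R ⊗[P] M)).1 inferInstance

instance baseChangeFunctor_preservesHomology [Module.Flat P R] :
    (baseChangeFunctor P R).PreservesHomology := by
  refine ((Functor.exact_tfae (baseChangeFunctor P R)).out 1 2).1 fun S hS => ?_
  rw [ShortComplex.ShortExact.moduleCat_exact_iff_function_exact] at hS ⊢
  exact Module.Flat.lTensor_exact R hS

end BaseChange

/-- The complex `A ⊗ F` is exact in all degrees greater than `j`. -/
def ExactAbove {P : Type} [CommRing P] (F : ChainComplex (ModuleCat.{0} P) ℕ) (A : Type)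
    [AddCommGroup A] [Module P A] (j : ℕ) : Prop :=
  ∀ i, j ≤ i → Function.Exact ((F.d (i + 2) (i + 1)).hom.lTensor A) ((F.d (i + 1) i).hom.lTensor A)

section ExactAbove

variable {P : Type} [CommRing P] {F : ChainComplex (ModuleCat.{0} P) ℕ}
  {A B : Type} [AddCommGroup A] [Module P A] [AddCommGroup B] [Module P B] {j : ℕ}

theorem ExactAbove.of_flat [Module.Flat P A] {N : ModuleCat.{0} P} (F : ProjectiveResolution N) :
    ExactAbove F.complex A 0 := by
  intro i _
  have := F.exact_succ i
  rw [ShortComplex.ShortExact.moduleCat_exact_iff_function_exact] at this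
  exact Module.Flat.lTensor_exact A this

theorem ExactAbove.of_equiv (h : ExactAbove F A j) (e : A ≃ₗ[P] B) : ExactAbove F B j := by
  intro i hi
  refine (Function.Exact.iff_of_ladder_linearEquiv
    (f₁₂ := (F.d (i + 2) (i + 1)).hom.lTensor A) (f₂₃ := (F.d (i + 1) i).hom.lTensor A)
    (e₁ := e.rTensor (F.X (i + 2)))
    (e₂ := e.rTensor (F.X (i + 1))) (e₃ := e.rTensor (F.X i)) ?_ ?_).2 (h i hi)
  · ext; rfl
  · ext; rfl

/-- This is the long exact homology sequence of 0 → A ⊗ F → A ⊗ F → B ⊗ F → 0, carried out as a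
diagram chase. The sequence is exact on the left because the terms of F are flat. The connecting map
lowers the degree by one, which is why the bound grows by one. -/
theorem ExactAbove.of_quotient (hF : ∀ i, Module.Flat P (F.X i)) (h : ExactAbove F A j)
    (f : A →ₗ[P] A) (g : A →ₗ[P] B) (hf : Function.Injective f) (hfg : Function.Exact f g)
    (hg : Function.Surjective g) : ExactAbove F B (j + 1) := by
  intro i hi
  obtain ⟨i, rfl⟩ : ∃ i', i = i' + 1 := ⟨i - 1, by omega⟩
  have dd (C : Type) [AddCommGroup C] [Module P C] (i : ℕ) (z : C ⊗[P] F.X (i + 2)) :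
      (F.d (i + 1) i).hom.lTensor C ((F.d (i + 2) (i + 1)).hom.lTensor C z) = 0 := by
    rw [← LinearMap.comp_apply, ← LinearMap.lTensor_comp, ← ModuleCat.hom_comp,
      F.d_comp_d]
    simp
  have comm {C D : Type} [AddCommGroup C] [Module P C] [AddCommGroup D] [Module P D]
      (φ : C →ₗ[P] D) (a b : ℕ) (z : C ⊗[P] F.X a) :
      (F.d a b).hom.lTensor D (φ.rTensor (F.X a) z) =
        φ.rTensor (F.X b) ((F.d a b).hom.lTensor C z) := by
    rw [← LinearMap.comp_apply, ← LinearMap.comp_apply, LinearMap.lTensor_comp_rTensor,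
      LinearMap.rTensor_comp_lTensor]
  intro z
  constructor
  · intro hz
    obtain ⟨z, rfl⟩ := LinearMap.rTensor_surjective (F.X (i + 1 + 1)) hg z
    rw [comm] at hz
    obtain ⟨u, hu⟩ := (rTensor_exact (F.X (i + 1)) hfg hg _).1 hz
    have hdu : (F.d (i + 1) i).hom.lTensor A u = 0 := by
      have := hF i
      apply Module.Flat.rTensor_preserves_injective_linearMap (M := F.X i) f hf
      rw [← comm, hu, map_zero]
      exact dd A i z
    obtain ⟨v, rfl⟩ := (h i (by omega) u).1 hdu
    rw [← comm] at hu
    have hz' : (F.d (i + 1 + 1) (i + 1)).hom.lTensor A (z - f.rTensor _ v) = 0 := by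
      rw [map_sub, sub_eq_zero]
      exact hu.symm
    obtain ⟨y, hy⟩ := (h (i + 1) (by omega) _).1 hz'
    refine ⟨g.rTensor _ y, ?_⟩
    rw [comm, hy, map_sub]
    have : g.rTensor (F.X (i + 1 + 1)) (f.rTensor _ v) = 0 :=
      (rTensor_exact _ hfg hg _).2 ⟨v, rfl⟩
    rw [this, sub_zero]
  · rintro ⟨y, rfl⟩
    exact dd B (i + 1) y

end ExactAbove

/-- Flat base change for the vanishing of `Tor`: if `R` is flat over `P`, then
`Tor^R (A, R ⊗ N)` is computed by `A ⊗ F`, where `F` is a resolution of `N` over `P`. -/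
theorem isZero_tor_of_exactAbove {P R : Type} [CommRing P] [CommRing R] [Algebra P R]
    [Module.Flat P R] {A : Type} [AddCommGroup A] [Module R A] [Module P A] [IsScalarTower P R A]
    {N : ModuleCat.{0} P} (F : ProjectiveResolution N) {j i : ℕ} (h : ExactAbove F.complex A j)
    (hi : j < i) {B : ModuleCat.{0} R} (e : R ⊗[P] N ≃ₗ[R] B) :
    Limits.IsZero (((Tor (ModuleCat.{0} R) i).obj (ModuleCat.of R A)).obj B) := by
  obtain ⟨i, rfl⟩ : ∃ i', i = i' + 1 := ⟨i - 1, by omega⟩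
  -- R ⊗ F is a projective resolution of R ⊗ N by flatness, and A ⊗_R (R ⊗_P F) = A ⊗_P F.
  let G := (baseChangeFunctor P R).mapProjectiveResolution F
  refine Limits.IsZero.of_iso ?_ ((((Tor (ModuleCat.{0} R) (i + 1)).obj (ModuleCat.of R A)).mapIso
    (show B ≅ (baseChangeFunctor P R).obj N from e.symm.toModuleIso)) ≪≫
    G.isoLeftDerivedObj _ _)
  refine HomologicalComplex.ExactAt.isZero_homology ?_
  rw [HomologicalComplex.exactAt_iff' _ (i + 2) (i + 1) i (by simp) (by simp),
    ShortComplex.ShortExact.moduleCat_exact_iff_function_exact]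
  refine (Function.Exact.iff_of_ladder_linearEquiv
    (f₁₂ := (F.complex.d (i + 2) (i + 1)).hom.lTensor A)
    (f₂₃ := (F.complex.d (i + 1) i).hom.lTensor A)
    (g₁₂ := ((F.complex.d (i + 2) (i + 1)).hom.baseChange R).lTensor A |>.restrictScalars P)
    (g₂₃ := ((F.complex.d (i + 1) i).hom.baseChange R).lTensor A |>.restrictScalars P)
    (e₁ := ((AlgebraTensorModule.cancelBaseChange P R R A
      (F.complex.X (i + 2))).symm.restrictScalars P))
    (e₂ := ((AlgebraTensorModule.cancelBaseChange P R R A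
      (F.complex.X (i + 1))).symm.restrictScalars P))
    (e₃ := ((AlgebraTensorModule.cancelBaseChange P R R A
      (F.complex.X i)).symm.restrictScalars P)) ?_ ?_).2
    (h i (by omega))
  · ext; rfl
  · ext; rfl

/-! ### Leading terms and freeness of polynomial rings -/

namespace MvPolynomial

section LeadingTerm

variable {σ : Type} (w : σ → ℕ)

/-- The term `u X^β` of `f` has larger weight than all other terms of `f`. -/
def HasLeadingTerm (f : MvPolynomial σ ℤ) (β : σ →₀ ℕ) (u : ℤˣ) : Prop :=
  ∀ γ ∈ (f - monomial β (u : ℤ)).support, Finsupp.weight w γ < Finsupp.weight w β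

variable {w}

theorem HasLeadingTerm.coeff_self {f : MvPolynomial σ ℤ} {β : σ →₀ ℕ} {u : ℤˣ}
    (h : HasLeadingTerm w f β u) : f.coeff β = u := by
  by_contra hne
  refine lt_irrefl _ (h β ?_)
  classical
  rw [mem_support_iff, coeff_sub, coeff_monomial, if_pos rfl]
  exact sub_ne_zero.2 hne

theorem HasLeadingTerm.eq_or_lt {f : MvPolynomial σ ℤ} {β γ : σ →₀ ℕ} {u : ℤˣ}
    (h : HasLeadingTerm w f β u) (hγ : γ ∈ f.support) :
    γ = β ∨ Finsupp.weight w γ < Finsupp.weight w β := by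
  classical
  by_cases hne : γ = β
  · exact Or.inl hne
  · refine Or.inr (h γ ?_)
    rw [mem_support_iff, coeff_sub, coeff_monomial, if_neg (Ne.symm hne), sub_zero]
    exact mem_support_iff.1 hγ

theorem HasLeadingTerm.weight_le {f : MvPolynomial σ ℤ} {β γ : σ →₀ ℕ} {u : ℤˣ}
    (h : HasLeadingTerm w f β u) (hγ : γ ∈ f.support) :
    Finsupp.weight w γ ≤ Finsupp.weight w β := by
  rcases h.eq_or_lt hγ with rfl | h
  · exact le_rfl
  · exact h.le

theorem hasLeadingTerm_monomial (β : σ →₀ ℕ) : HasLeadingTerm w (monomial β 1) β 1 := by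
  simp [HasLeadingTerm]

theorem HasLeadingTerm.mul {f g : MvPolynomial σ ℤ} {β γ : σ →₀ ℕ} {u v : ℤˣ}
    (hf : HasLeadingTerm w f β u) (hg : HasLeadingTerm w g γ v) :
    HasLeadingTerm w (f * g) (β + γ) (u * v) := by
  classical
  intro δ hδ
  have key : f * g - monomial (β + γ) ((u * v : ℤˣ) : ℤ) =
      (f - monomial β (u : ℤ)) * g + monomial β (u : ℤ) * (g - monomial γ (v : ℤ)) := by
    rw [mul_sub, monomial_mul, Units.val_mul]
    ring
  rw [key] at hδ
  rw [map_add]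
  rcases Finset.mem_union.1 (support_add hδ) with h | h
  · obtain ⟨a, ha, b, hb, rfl⟩ := Finset.mem_add.1 (support_mul _ _ h)
    rw [map_add]
    exact add_lt_add_of_lt_of_le (hf a ha) (hg.weight_le hb)
  · obtain ⟨a, ha, b, hb, rfl⟩ := Finset.mem_add.1 (support_mul _ _ h)
    rw [map_add]
    have : a = β := Finset.mem_singleton.1 (support_monomial_subset ha)
    rw [this]
    exact add_lt_add_of_le_of_lt le_rfl (hg b hb)

theorem HasLeadingTerm.one : HasLeadingTerm w 1 0 1 := hasLeadingTerm_monomial 0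

theorem HasLeadingTerm.pow {f : MvPolynomial σ ℤ} {β : σ →₀ ℕ} {u : ℤˣ}
    (hf : HasLeadingTerm w f β u) (n : ℕ) : HasLeadingTerm w (f ^ n) (n • β) (u ^ n) := by
  induction n with
  | zero => simpa using HasLeadingTerm.one
  | succ n ih => simpa [pow_succ, succ_nsmul] using ih.mul hf

theorem HasLeadingTerm.prod {ι : Type} (s : Finset ι) {f : ι → MvPolynomial σ ℤ}
    {β : ι → σ →₀ ℕ} {u : ι → ℤˣ} (hf : ∀ i, HasLeadingTerm w (f i) (β i) (u i)) :
    HasLeadingTerm w (∏ i ∈ s, f i) (∑ i ∈ s, β i) (∏ i ∈ s, u i) := by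
  classical
  induction s using Finset.induction_on with
  | empty => simpa using HasLeadingTerm.one
  | insert i s hi ih => simpa [Finset.prod_insert hi, Finset.sum_insert hi] using (hf i).mul ih

end LeadingTerm

section Division

variable {σ ι : Type} [Fintype ι] (m : ι → σ →₀ ℕ)

/-- A monomial is reduced when it is divisible by none of the monomials `X^(m i)`. -/
def IsReduced (ν : σ →₀ ℕ) : Prop := ∀ i, ¬ m i ≤ ν

variable {m}

theorem exists_reduced (hm : ∀ i, m i ≠ 0) (β : σ →₀ ℕ) :
    ∃ (ν : σ →₀ ℕ) (κ : ι →₀ ℕ), IsReduced m ν ∧ β = ν + ∑ i, κ i • m i := by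
  classical
  induction hd : β.degree using Nat.strong_induction_on generalizing β with
  | _ d ih =>
    by_cases h : IsReduced m β
    · exact ⟨β, 0, h, by simp⟩
    · simp only [IsReduced, not_forall, not_not] at h
      obtain ⟨i, hi⟩ := h
      obtain ⟨γ, rfl⟩ := exists_add_of_le hi
      have hpos : 0 < (m i).degree := by
        rw [Nat.pos_iff_ne_zero, Ne, Finsupp.degree_eq_zero_iff]
        exact hm i
      rw [map_add] at hd
      obtain ⟨ν, κ, hν, rfl⟩ := ih γ.degree (by omega) γ rfl
      refine ⟨ν, κ + Finsupp.single i 1, hν, ?_⟩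
      simp only [Finsupp.add_apply, add_smul, Finset.sum_add_distrib, Finsupp.single_apply,
        ite_smul, one_smul, zero_smul, Finset.sum_ite_eq, Finset.mem_univ, if_true]
      abel

theorem sum_smul_apply (hdisj : Pairwise fun i j => Disjoint (m i).support (m j).support)
    (κ : ι →₀ ℕ) {i : ι} {s : σ} (hs : s ∈ (m i).support) :
    (∑ j, κ j • m j) s = κ i * m i s := by
  rw [Finsupp.finsetSum_apply, Finset.sum_eq_single i]
  · simp
  · intro j _ hj
    have := Finset.disjoint_left.1 (hdisj hj.symm) hs
    simp [Finsupp.notMem_support_iff.1 this]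
  · simp

/-- On a variable of X^(m i) no other m j contributes, so κ i < κ' i would force X^(m i) to divide
X^ν. -/
theorem reduced_exponent_le (hdisj : Pairwise fun i j => Disjoint (m i).support (m j).support)
    {ν ν' : σ →₀ ℕ} (hν : IsReduced m ν) {κ κ' : ι →₀ ℕ}
    (h : ν + ∑ i, κ i • m i = ν' + ∑ i, κ' i • m i) (i : ι) : κ' i ≤ κ i := by
  by_contra! hlt
  refine hν i fun s => ?_
  by_cases hs : s ∈ (m i).support
  · have := DFunLike.congr_fun h s
    rw [Finsupp.add_apply, Finsupp.add_apply, sum_smul_apply hdisj κ hs,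
      sum_smul_apply hdisj κ' hs] at this
    have h2 : (κ i + 1) * m i s ≤ κ' i * m i s := Nat.mul_le_mul_right _ hlt
    rw [add_mul, one_mul] at h2
    omega
  · rw [Finsupp.notMem_support_iff.1 hs]
    exact Nat.zero_le _

theorem reduced_unique (hdisj : Pairwise fun i j => Disjoint (m i).support (m j).support)
    {ν ν' : σ →₀ ℕ} (hν : IsReduced m ν) (hν' : IsReduced m ν') {κ κ' : ι →₀ ℕ}
    (h : ν + ∑ i, κ i • m i = ν' + ∑ i, κ' i • m i) : ν = ν' ∧ κ = κ' := by
  have hκ : κ = κ' := by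
    ext i
    exact le_antisymm (reduced_exponent_le hdisj hν' h.symm i) (reduced_exponent_le hdisj hν h i)
  subst hκ
  exact ⟨add_right_cancel h, rfl⟩

end Division

section Free

variable {σ ι : Type} [Fintype ι] {q : ι → MvPolynomial σ ℤ} {m : ι → σ →₀ ℕ} {u : ι → ℤˣ}
  {w : σ → ℕ} [Algebra (MvPolynomial ι ℤ) (MvPolynomial σ ℤ)]

theorem smul_eq_sum (hq : ∀ i, algebraMap (MvPolynomial ι ℤ) (MvPolynomial σ ℤ) (X i) = q i)
    (f : MvPolynomial ι ℤ) (g : MvPolynomial σ ℤ) :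
    f • g = ∑ κ ∈ f.support, C (f.coeff κ) * (g * ∏ i, q i ^ κ i) := by
  have : algebraMap (MvPolynomial ι ℤ) (MvPolynomial σ ℤ) = (aeval q).toRingHom :=
    ringHom_ext (by simp) (by simp [hq])
  rw [Algebra.smul_def, this]
  conv_lhs => rw [f.as_sum]
  simp only [AlgHom.toRingHom_eq_coe, map_sum, Finset.sum_mul]
  refine Finset.sum_congr rfl fun κ _ => ?_
  rw [RingHom.coe_coe, aeval_monomial, Finsupp.prod_fintype _ _ (fun i => pow_zero _)]
  rw [show (algebraMap ℤ (MvPolynomial σ ℤ)) (coeff κ f) = C (coeff κ f) from rfl]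
  ring

/-- If polynomials have leading monomials without common variables, then they make the polynomial
ring a free module, with the reduced monomials as a basis. -/
theorem free_of_hasLeadingTerm
    (hq : ∀ i, algebraMap (MvPolynomial ι ℤ) (MvPolynomial σ ℤ) (X i) = q i)
    (hlead : ∀ i, HasLeadingTerm w (q i) (m i) (u i)) (hm : ∀ i, m i ≠ 0)
    (hdisj : Pairwise fun i j => Disjoint (m i).support (m j).support) :
    Module.Free (MvPolynomial ι ℤ) (MvPolynomial σ ℤ) := by
  classical
  have hb (ν : σ →₀ ℕ) (κ : ι →₀ ℕ) : HasLeadingTerm w (monomial ν 1 * ∏ i, q i ^ κ i)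
      (ν + ∑ i, κ i • m i) (1 * ∏ i, u i ^ κ i) :=
    (hasLeadingTerm_monomial ν).mul (HasLeadingTerm.prod _ fun i => (hlead i).pow _)
  let v : {ν : σ →₀ ℕ // IsReduced m ν} → MvPolynomial σ ℤ := fun ν => monomial ν.1 1
  refine Module.Free.of_basis (Module.Basis.mk (v := v) ?_ ?_)
  · rw [linearIndependent_iff]
    intro l hl
    by_contra hne
    let S := l.support.sigma fun ν => (l ν).support
    have hS : S.Nonempty := by
      obtain ⟨ν, hν⟩ := Finsupp.support_nonempty_iff.2 hne
      obtain ⟨κ, hκ⟩ := support_nonempty.2 (Finsupp.mem_support_iff.1 hν)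
      exact ⟨⟨ν, κ⟩, Finset.mem_sigma.2 ⟨hν, hκ⟩⟩
    -- In a relation, take a product whose leading exponent has maximal weight. Any other product
    -- containing this monomial would have the same leading exponent, excluded by `reduced_unique`,
    -- or one of larger weight, excluded by maximality.
    obtain ⟨⟨ν₀, κ₀⟩, hmem, hmax⟩ := S.exists_max_image
      (fun x => Finsupp.weight w (x.1.1 + ∑ i, x.2 i • m i)) hS
    have hsum : ∑ x ∈ S, C ((l x.1).coeff x.2) * (monomial x.1.1 1 * ∏ i, q i ^ x.2 i) = 0 := by
      refine Eq.trans (Finset.sum_sigma _ _ _) (Eq.trans ?_ hl)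
      refine Eq.trans ?_ (Finsupp.linearCombination_apply _ l).symm
      exact Finset.sum_congr rfl fun ν _ => (smul_eq_sum hq (l ν) (v ν)).symm
    have hcoeff := congrArg (coeff (ν₀.1 + ∑ i, κ₀ i • m i)) hsum
    rw [coeff_sum, Finset.sum_eq_single ⟨ν₀, κ₀⟩, coeff_C_mul, (hb _ _).coeff_self,
      coeff_zero] at hcoeff
    · have h0 := (mul_eq_zero.1 hcoeff).resolve_right (Units.ne_zero _)
      exact mem_support_iff.1 (Finset.mem_sigma.1 hmem).2 h0
    · rintro ⟨ν, κ⟩ hx hxne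
      rw [coeff_C_mul]
      by_contra h0
      rcases (hb ν κ).eq_or_lt (mem_support_iff.2 (right_ne_zero_of_mul h0)) with h | h
      · obtain ⟨h1, h2⟩ := reduced_unique hdisj ν₀.2 ν.2 h
        exact hxne (by rw [Subtype.ext h1, h2])
      · exact absurd (hmax _ hx) (not_le.2 h)
    · exact fun h => absurd hmem h
  -- Spanning: each monomial is, up to sign, the leading term of a product in the span, and the
  -- remainder has smaller weight.
  · have key : ∀ (d : ℕ) (f : MvPolynomial σ ℤ), (∀ γ ∈ f.support, Finsupp.weight w γ < d) →
        f ∈ Submodule.span (MvPolynomial ι ℤ) (Set.range v) := by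
      intro d
      induction d with
      | zero =>
        intro f hf
        rw [support_eq_empty.1 (Finset.eq_empty_of_forall_notMem fun γ hγ =>
          absurd (hf γ hγ) (Nat.not_lt_zero _))]
        exact zero_mem _
      | succ d ih =>
        intro f hf
        rw [f.as_sum]
        refine Submodule.sum_mem _ fun β hβ => ?_
        obtain ⟨ν, κ, hν, rfl⟩ := exists_reduced hm β
        set e : ℤˣ := 1 * ∏ i, u i ^ κ i with he
        have h1 : monomial ν 1 * ∏ i, q i ^ κ i ∈
            Submodule.span (MvPolynomial ι ℤ) (Set.range v) := by
          have : monomial ν 1 * ∏ i, q i ^ κ i =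
              (monomial κ (1 : ℤ) : MvPolynomial ι ℤ) • v ⟨ν, hν⟩ := by
            rw [smul_eq_sum hq, support_monomial, if_neg one_ne_zero, Finset.sum_singleton,
              coeff_monomial, if_pos rfl, C_1, one_mul]
          rw [this]
          exact Submodule.smul_mem _ _ (Submodule.subset_span ⟨_, rfl⟩)
        have h2 := ih _ fun γ hγ => (hb ν κ γ hγ).trans_le (Nat.lt_succ_iff.1 (hf _ hβ))
        have h3 := Submodule.sub_mem _ h1 h2
        rw [sub_sub_cancel] at h3
        have h4 : monomial (ν + ∑ i, κ i • m i) (coeff (ν + ∑ i, κ i • m i) f) =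
            (coeff (ν + ∑ i, κ i • m i) f * (e : ℤ)) •
              monomial (ν + ∑ i, κ i • m i) (e : ℤ) := by
          rw [smul_monomial, smul_eq_mul, mul_assoc, ← Units.val_mul, Int.units_mul_self]
          simp
        rw [h4]
        exact zsmul_mem h3 _
    intro f _
    refine key (f.support.sup (Finsupp.weight w) + 1) f fun γ hγ => ?_
    exact Nat.lt_succ_iff.2 (Finset.le_sup hγ)

end Free

end MvPolynomial

/-! ### Flatness and nonzerodivisors in quotient rings -/

/-- Let `R'` be flat over `B`. A quotient `A` of `R'` by the extension of the kernel of a surjection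
`B → C` is flat over `C`. -/
theorem flat_of_surjective_of_ker {B C R' A : Type} [CommRing B] [CommRing C] [CommRing R']
    [CommRing A] [Algebra B C] [Algebra B R'] [Algebra B A] [Algebra C A] [Algebra R' A]
    [IsScalarTower B R' A] [IsScalarTower B C A] [Module.Flat B R']
    (hC : Function.Surjective (algebraMap B C)) (hA : Function.Surjective (algebraMap R' A))
    (hker : RingHom.ker (algebraMap R' A) ≤
      (RingHom.ker (algebraMap B C)).map (algebraMap B R')) : Module.Flat C A := by
  -- The hypotheses say that A is the base change C ⊗_B R', and flatness survives base change.
  let ψ : C ⊗[B] R' →ₐ[C] A := Algebra.TensorProduct.lift (Algebra.ofId C A)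
    (IsScalarTower.toAlgHom B R' A) fun _ _ => Commute.all _ _
  have hψ (x : R') : ψ (1 ⊗ₜ x) = algebraMap R' A x := by simp [ψ]
  have hone (z : C ⊗[B] R') : ∃ x, z = 1 ⊗ₜ x := by
    induction z using TensorProduct.induction_on with
    | zero => exact ⟨0, (tmul_zero _ _).symm⟩
    | tmul c x =>
      obtain ⟨b, rfl⟩ := hC c
      refine ⟨b • x, ?_⟩
      rw [← TensorProduct.smul_tmul, Algebra.smul_def, mul_one]
    | add y z hy hz =>
      obtain ⟨y, rfl⟩ := hy
      obtain ⟨z, rfl⟩ := hz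
      exact ⟨y + z, (tmul_add _ _ _).symm⟩
  have hle : (RingHom.ker (algebraMap B C)).map (algebraMap B R') ≤
      RingHom.ker (Algebra.TensorProduct.includeRight : R' →ₐ[B] C ⊗[B] R') := by
    rw [Ideal.map_le_iff_le_comap]
    intro b hb
    rw [Ideal.mem_comap, RingHom.mem_ker, Algebra.TensorProduct.includeRight_apply,
      Algebra.algebraMap_eq_smul_one, ← TensorProduct.smul_tmul, Algebra.smul_def,
      RingHom.mem_ker.1 hb, zero_mul, zero_tmul]
  have hbij : Function.Bijective ψ := by
    constructor
    · rw [injective_iff_map_eq_zero]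
      intro z hz
      obtain ⟨x, rfl⟩ := hone z
      rw [hψ] at hz
      exact hle (hker hz)
    · intro y
      obtain ⟨x, rfl⟩ := hA y
      exact ⟨1 ⊗ₜ x, hψ x⟩
  exact Module.Flat.of_linearEquiv (LinearEquiv.ofBijective ψ.toLinearMap hbij).symm

/-- An element on which some family of endomorphisms that preserves `I` acts as a translation is a
nonzerodivisor modulo `I`. -/
theorem Ideal.mem_of_mul_mem_of_translation {R : Type} [CommRing R] (I : Ideal R) (d : R)
    (τ : R →+* Polynomial R) (h0 : ∀ x, (τ x).eval 0 = x)
    (hI : I ≤ (I.map Polynomial.C).comap τ) (hd : τ d = Polynomial.X + Polynomial.C d)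
    {x : R} (hx : d * x ∈ I) : x ∈ I := by
  have h1 := hI hx
  rw [Ideal.mem_comap, map_mul, hd] at h1
  have hmem (p : Polynomial R) :
      p ∈ I.map Polynomial.C ↔ p.map (Ideal.Quotient.mk I) = 0 := by
    rw [Ideal.mem_map_C_iff, Polynomial.ext_iff]
    simp [Ideal.Quotient.eq_zero_iff_mem]
  rw [hmem, Polynomial.map_mul, Polynomial.map_add, Polynomial.map_X, Polynomial.map_C,
    mul_comm] at h1
  -- A monic polynomial is a nonzerodivisor over any ring, here over R/I. Hence τ x vanishes modulo
  -- I, and evaluation at 0 recovers x.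
  have h2 := (Polynomial.monic_X_add_C (Ideal.Quotient.mk I d)).mul_left_eq_zero_iff.1 h1
  have h3 := congrArg (Polynomial.eval 0) h2
  rwa [← map_zero (Ideal.Quotient.mk I), Polynomial.eval_map_apply, h0, map_zero,
    Polynomial.eval_zero,
    Ideal.Quotient.eq_zero_iff_mem] at h3

/-- Flatness starts the induction at bound 0; each further element of s is a nonzerodivisor modulo
the previous ones and costs one degree. -/
theorem exactAbove_quotient_sup_span {P R J : Type} [CommRing P] [CommRing R] [Algebra P R]
    (L : Ideal R) (D : J → R)
    (hD : ∀ (s : Finset J) (j : J), j ∉ s → ∀ x, D j * x ∈ L ⊔ Ideal.span (D '' s) →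
      x ∈ L ⊔ Ideal.span (D '' s))
    [Module.Flat P (R ⧸ L)] {N : ModuleCat.{0} P} (F : ProjectiveResolution N) (s : Finset J) :
    ExactAbove F.complex (R ⧸ (L ⊔ Ideal.span (D '' (s : Set J)))) s.card := by
  classical
  have hF (i : ℕ) : Module.Flat P (F.complex.X i) := by
    have : Module.Projective P (F.complex.X i) :=
      (IsProjective.iff_projective (F.complex.X i)).2 (F.projective i)
    infer_instance
  induction s using Finset.induction_on with
  | empty =>
    have e : L = L ⊔ Ideal.span (D '' ((∅ : Finset J) : Set J)) := by simp
    exact (ExactAbove.of_flat F).of_equiv (Ideal.quotientEquivAlgOfEq P e).toLinearEquiv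
  | insert j s hj ih =>
    rw [Finset.card_insert_of_notMem hj]
    set I := L ⊔ Ideal.span (D '' (s : Set J)) with hI
    have hle : I ≤ L ⊔ Ideal.span (D '' ((insert j s : Finset J) : Set J)) := by
      refine sup_le_sup_left (Ideal.span_mono (Set.image_mono ?_)) _
      exact Finset.coe_subset.2 (Finset.subset_insert _ _)
    refine ih.of_quotient hF (LinearMap.mulLeft P (Ideal.Quotient.mk I (D j)))
      (Ideal.Quotient.factorₐ P hle).toLinearMap ?_ ?_ ?_
    · rw [injective_iff_map_eq_zero]
      intro x hx
      obtain ⟨x, rfl⟩ := Ideal.Quotient.mk_surjective x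
      rw [LinearMap.mulLeft_apply, ← map_mul, Ideal.Quotient.eq_zero_iff_mem] at hx
      exact Ideal.Quotient.eq_zero_iff_mem.2 (hD s j hj x hx)
    · intro x
      obtain ⟨x, rfl⟩ := Ideal.Quotient.mk_surjective x
      have h1 : (Ideal.Quotient.factorₐ P hle).toLinearMap (Ideal.Quotient.mk I x) =
        Ideal.Quotient.mk _ x := rfl
      rw [h1, Ideal.Quotient.eq_zero_iff_mem, Finset.coe_insert, Set.image_insert_eq,
        Ideal.span_insert, sup_left_comm, ← hI, Ideal.mem_span_singleton_sup]
      constructor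
      · rintro ⟨y, b, hb, rfl⟩
        refine ⟨Ideal.Quotient.mk I y, ?_⟩
        rw [LinearMap.mulLeft_apply, ← map_mul, map_add, Ideal.Quotient.eq_zero_iff_mem.2 hb,
          add_zero, mul_comm]
      · rintro ⟨y, hy⟩
        obtain ⟨y, rfl⟩ := Ideal.Quotient.mk_surjective y
        rw [LinearMap.mulLeft_apply, ← map_mul, Ideal.Quotient.eq] at hy
        refine ⟨y, x - D j * y, ?_, by ring⟩
        rw [← neg_sub]
        exact neg_mem hy
    · exact Ideal.Quotient.factor_surjective hle

/-! ### Identification of variables, and bounds on weights -/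

namespace MvPolynomial

/-- Modulo the differences the variables are constant on classes, so the quotient map factors
through `rename (Quot.mk r)`. -/
theorem ker_rename_quot {σ : Type} (r : σ → σ → Prop) :
    RingHom.ker (rename (R := ℤ) (Quot.mk r)) =
      Ideal.span (Set.range fun x : {x : σ × σ // r x.1 x.2} =>
        (X x.1.2 - X x.1.1 : MvPolynomial σ ℤ)) := by
  apply le_antisymm
  · generalize hI : Ideal.span (Set.range fun x : {x : σ × σ // r x.1 x.2} =>
      (X x.1.2 - X x.1.1 : MvPolynomial σ ℤ)) = I
    have hX (s t : σ) (h : r s t) : Ideal.Quotient.mk I (X s) = Ideal.Quotient.mk I (X t) := by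
      refine (Ideal.Quotient.eq.2 ?_).symm
      rw [← hI]
      exact Ideal.subset_span ⟨⟨(s, t), h⟩, rfl⟩
    let ψ : MvPolynomial (Quot r) ℤ →+* MvPolynomial σ ℤ ⧸ I :=
      eval₂Hom (Int.castRingHom _) (Quot.lift (fun s => Ideal.Quotient.mk I (X s)) hX)
    have hψ : ψ.comp (rename (R := ℤ) (Quot.mk r)).toRingHom = Ideal.Quotient.mk I :=
      ringHom_ext (by simp) (by simp [ψ])
    intro x hx
    rw [← Ideal.Quotient.eq_zero_iff_mem, ← hψ]
    simp [RingHom.mem_ker.1 hx]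
  · rw [Ideal.span_le]
    rintro _ ⟨⟨⟨s, t⟩, h⟩, rfl⟩
    simp only [SetLike.mem_coe, RingHom.mem_ker, map_sub, rename_X]
    rw [Quot.sound h, sub_self]

end MvPolynomial

namespace MvPolynomial

section

variable {σ : Type} {w : σ → ℕ} {n : ℕ} {f g : MvPolynomial σ ℤ}

/-- All terms of `f` have weight less than `n`. -/
def WeightLT (w : σ → ℕ) (n : ℕ) (f : MvPolynomial σ ℤ) : Prop :=
  ∀ γ ∈ f.support, Finsupp.weight w γ < n

theorem WeightLT.sub (hf : WeightLT w n f) (hg : WeightLT w n g) : WeightLT w n (f - g) := by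
  classical
  intro γ hγ
  exact (Finset.mem_union.1 (support_sub _ _ _ hγ)).elim (hf γ) (hg γ)

theorem WeightLT.add (hf : WeightLT w n f) (hg : WeightLT w n g) : WeightLT w n (f + g) := by
  classical
  intro γ hγ
  exact (Finset.mem_union.1 (support_add hγ)).elim (hf γ) (hg γ)

theorem weightLT_X {s : σ} (h : w s < n) : WeightLT w n (X s) := by
  intro γ hγ
  rw [support_X, Finset.mem_singleton] at hγ
  simpa [hγ, Finsupp.weight_single] using h

theorem weightLT_X_mul_X {s t : σ} (h : w s + w t < n) :
    WeightLT w n (X s * X t) := by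
  intro γ hγ
  rw [X, X, monomial_mul] at hγ
  rw [Finset.mem_singleton.1 (support_monomial_subset hγ)]
  simpa [Finsupp.weight_single] using h

end

/-- In the applications every variable of a leading monomial is an outgoing segment, and the label
is the relation to which that segment is assigned. -/
theorem pairwise_disjoint_of_label {ι σ α : Type} {out : α → σ} (hout : Function.Injective out)
    (label : α → ι) (m : ι → σ →₀ ℕ)
    (h : ∀ i, ∀ s ∈ (m i).support, ∃ x, s = out x ∧ label x = i) :
    Pairwise fun i j => Disjoint (m i).support (m j).support := by
  intro i j hij
  rw [Finset.disjoint_left]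
  intro s hi hj
  obtain ⟨x, rfl, rfl⟩ := h i s hi
  obtain ⟨y, hy, rfl⟩ := h j _ hj
  exact hij (by rw [hout hy])

end MvPolynomial

/-! ### Abstract braid closures and their leading terms -/

open MvPolynomial

/-- The combinatorics of a braid closure: segments `σ`, four-valent and two-valent vertices with
their outgoing (`a`, `b`, `e`) and incoming (`c`, `d`, `f`) segments, and a relation `r` that glues
the end of a segment to the beginning of another one. -/
structure BraidData (σ V₄ V₂ : Type) (r : σ → σ → Prop) where
  (a b c d : V₄ → σ)
  (e f : V₂ → σ)
  height : σ → ℕ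
  height_lt_a : ∀ p, height (b p) < height (a p)
  height_c_lt : ∀ p, height (c p) < height (b p)
  height_d_lt : ∀ p, height (d p) < height (b p)
  height_f_lt : ∀ p, height (f p) < height (e p)
  out_injective : Function.Injective
    (Sum.elim (Sum.elim a b) (Sum.elim e fun x : {x : σ × σ // r x.1 x.2} => x.1.2))
  -- The lower bound N allows a flow to be shifted to a weight with values in ℕ.
  exists_flow : ∀ (g₄ : V₄ → ℤ) (g₂ : V₂ → ℤ) (g : {x : σ × σ // r x.1 x.2} → ℤ), ∃ w : σ → ℤ,
    (∃ N, ∀ s, N ≤ w s) ∧ (∀ p, w (a p) + w (b p) - w (c p) - w (d p) = g₄ p) ∧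
      (∀ p, w (e p) - w (f p) = g₂ p) ∧ ∀ x, w x.1.2 - w x.1.1 = g x

namespace BraidData

variable {σ V₄ V₂ : Type} {r : σ → σ → Prop} (G : BraidData σ V₄ V₂ r)

/-- The linear polynomial of a four-valent vertex. -/
noncomputable def linear (p : V₄) : MvPolynomial σ ℤ :=
  X (G.a p) + X (G.b p) - X (G.c p) - X (G.d p)

/-- The polynomials that generate the ideal `Q`. -/
noncomputable def quadric : V₄ ⊕ V₂ → MvPolynomial σ ℤ :=
  Sum.elim (fun p => X (G.a p) * X (G.b p) - X (G.c p) * X (G.d p))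
    fun p => X (G.e p) - X (G.f p)

/-- The difference of the variables of two segments that are glued. -/
noncomputable def gluing (_ : BraidData σ V₄ V₂ r) (x : {x : σ × σ // r x.1 x.2}) :
    MvPolynomial σ ℤ :=
  X x.1.2 - X x.1.1

/-- The ideal of the linear polynomials before gluing. -/
noncomputable def openL : Ideal (MvPolynomial σ ℤ) := Ideal.span (Set.range G.linear)

/-- The quadric of a four-valent vertex modulo its linear polynomial. -/
noncomputable def reducedQuadric : V₄ ⊕ V₂ → MvPolynomial σ ℤ :=
  Sum.elim (fun p => (X (G.c p) * X (G.b p) + X (G.d p) * X (G.b p) - X (G.c p) * X (G.d p)) -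
    X (G.b p) * X (G.b p)) fun p => X (G.e p) - X (G.f p)

/-- The reduction substitutes X_c + X_d - X_b for X_a. It is needed because X_a X_b shares the
variable X_a with the leading monomial of L(p). -/
theorem quadric_sub_reducedQuadric_mem (v : V₄ ⊕ V₂) :
    G.quadric v - G.reducedQuadric v ∈ G.openL := by
  rcases v with p | p
  · have : G.quadric (Sum.inl p) - G.reducedQuadric (Sum.inl p) = X (G.b p) * G.linear p := by
      simp only [quadric, reducedQuadric, linear, Sum.elim_inl]
      ring
    rw [this]
    exact Ideal.mul_mem_left _ _ (Ideal.subset_span ⟨p, rfl⟩)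
  · simp [quadric, reducedQuadric]

variable [Fintype V₄] [Fintype V₂]

/-- With the height as weight, the leading terms are X_a for L(p), -X_b² for the reduced quadric and
X_e at two-valent vertices. They have no common variable because each segment leaves at most one
vertex. -/
theorem free_linear_reducedQuadric
    [Algebra (MvPolynomial (V₄ ⊕ (V₄ ⊕ V₂)) ℤ) (MvPolynomial σ ℤ)]
    (h : ∀ i, algebraMap (MvPolynomial (V₄ ⊕ (V₄ ⊕ V₂)) ℤ) (MvPolynomial σ ℤ) (X i) =
      Sum.elim G.linear G.reducedQuadric i) :
    Module.Free (MvPolynomial (V₄ ⊕ (V₄ ⊕ V₂)) ℤ) (MvPolynomial σ ℤ) := by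
  classical
  refine free_of_hasLeadingTerm (w := G.height) (u := Sum.elim 1 (Sum.elim (-1) 1))
    (m := Sum.elim (fun p => Finsupp.single (G.a p) 1)
      (Sum.elim (fun p => Finsupp.single (G.b p) 1 + Finsupp.single (G.b p) 1)
        fun p => Finsupp.single (G.e p) 1)) h ?_ ?_ ?_
  · rintro (p | p | p)
    · have h1 := G.height_lt_a p
      have h2 := G.height_c_lt p
      have h3 := G.height_d_lt p
      have : G.linear p - monomial (Finsupp.single (G.a p) 1) ((1 : ℤˣ) : ℤ) =
          X (G.b p) - X (G.c p) - X (G.d p) := by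
        rw [linear, Units.val_one, ← X]
        ring
      simp only [HasLeadingTerm, Sum.elim_inl, Pi.one_apply]
      rw [this]
      refine ((weightLT_X ?_).sub (weightLT_X ?_)).sub (weightLT_X ?_) <;>
        rw [Finsupp.weight_single, one_smul] <;> omega
    · have h2 := G.height_c_lt p
      have h3 := G.height_d_lt p
      have : G.reducedQuadric (Sum.inl p) - monomial (Finsupp.single (G.b p) 1 +
          Finsupp.single (G.b p) 1) (((-1 : ℤˣ)) : ℤ) =
          X (G.c p) * X (G.b p) + X (G.d p) * X (G.b p) - X (G.c p) * X (G.d p) := by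
        have : monomial (Finsupp.single (G.b p) 1 + Finsupp.single (G.b p) 1) (((-1 : ℤˣ)) : ℤ) =
            - (X (G.b p) * X (G.b p)) := by
          rw [X, monomial_mul, ← map_neg]
          simp
        rw [this]
        simp only [reducedQuadric, Sum.elim_inl]
        ring
      simp only [HasLeadingTerm, Sum.elim_inl, Sum.elim_inr, Pi.neg_apply, Pi.one_apply]
      rw [this]
      refine ((weightLT_X_mul_X ?_).add (weightLT_X_mul_X ?_)).sub (weightLT_X_mul_X ?_) <;>
        rw [map_add, Finsupp.weight_single, one_smul] <;> omega
    · have h1 := G.height_f_lt p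
      have : G.reducedQuadric (Sum.inr p) - monomial (Finsupp.single (G.e p) 1) ((1 : ℤˣ) : ℤ) =
          0 - X (G.f p) := by
        simp only [reducedQuadric, Sum.elim_inr]
        rw [Units.val_one, ← X]
        ring
      simp only [HasLeadingTerm, Sum.elim_inr, Pi.one_apply]
      rw [this]
      refine WeightLT.sub (fun γ hγ => by simp at hγ) (weightLT_X ?_)
      rw [Finsupp.weight_single, one_smul]
      omega
  · rintro (p | p | p) <;> simp
  · refine pairwise_disjoint_of_label (out := Sum.elim (Sum.elim G.a G.b) G.e) ?_
      (Sum.elim (Sum.elim Sum.inl fun p => Sum.inr (Sum.inl p)) fun p => Sum.inr (Sum.inr p)) _ ?_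
    · have := G.out_injective.comp (Sum.map_injective.2 ⟨Function.injective_id, Sum.inl_injective⟩)
      rwa [Sum.elim_comp_map, Sum.elim_comp_inl, Function.comp_id] at this
    rintro (p | p | p) s hs
    · refine ⟨Sum.inl (Sum.inl p), ?_, rfl⟩
      simpa [Finsupp.single_apply] using hs
    · refine ⟨Sum.inl (Sum.inr p), ?_, rfl⟩
      simpa [Finsupp.single_apply, eq_comm] using hs
    · refine ⟨Sum.inr p, ?_, rfl⟩
      simpa [Finsupp.single_apply] using hs

/-- With a flow as weight, the leading monomials are X_a X_b, X_e and the variable of the segment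
following a strand. -/
theorem free_gluing_quadric [Fintype {x : σ × σ // r x.1 x.2}]
    [Algebra (MvPolynomial ({x : σ × σ // r x.1 x.2} ⊕ (V₄ ⊕ V₂)) ℤ) (MvPolynomial σ ℤ)]
    (h : ∀ i, algebraMap (MvPolynomial ({x : σ × σ // r x.1 x.2} ⊕ (V₄ ⊕ V₂)) ℤ)
      (MvPolynomial σ ℤ) (X i) = Sum.elim G.gluing G.quadric i) :
    Module.Free (MvPolynomial ({x : σ × σ // r x.1 x.2} ⊕ (V₄ ⊕ V₂)) ℤ) (MvPolynomial σ ℤ) := by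
  classical
  -- Net flow 1 everywhere makes the outgoing term of each relation heavier than the incoming one.
  -- Subtracting N keeps this, since every node has as many outgoing as incoming segments.
  obtain ⟨w', ⟨N, hN⟩, h4, h2, hr⟩ := G.exists_flow 1 1 1
  obtain ⟨w, hw⟩ : ∃ w : σ → ℕ, ∀ s, (w s : ℤ) = w' s - N :=
    ⟨fun s => (w' s - N).toNat, fun s => Int.toNat_of_nonneg (sub_nonneg.2 (hN s))⟩
  simp only [Pi.one_apply] at h4 h2 hr
  refine free_of_hasLeadingTerm (w := w) (u := 1)
    (m := Sum.elim (fun x => Finsupp.single x.1.2 1)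
      (Sum.elim (fun p => Finsupp.single (G.a p) 1 + Finsupp.single (G.b p) 1)
        fun p => Finsupp.single (G.e p) 1)) h ?_ ?_ ?_
  · rintro (x | p | p)
    · have h1 := hr x
      have h2 := hw x.1.1
      have h3 := hw x.1.2
      have : G.gluing x - monomial (Finsupp.single x.1.2 1) ((1 : ℤˣ) : ℤ) = 0 - X x.1.1 := by
        rw [gluing, Units.val_one, ← X]
        ring
      simp only [HasLeadingTerm, Sum.elim_inl, Pi.one_apply]
      rw [this]
      refine WeightLT.sub (fun γ hγ => by simp at hγ) (weightLT_X ?_)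
      rw [Finsupp.weight_single, one_smul]
      omega
    · have h1 := h4 p
      have ha := hw (G.a p)
      have hb := hw (G.b p)
      have hc := hw (G.c p)
      have hd := hw (G.d p)
      have : G.quadric (Sum.inl p) - monomial (Finsupp.single (G.a p) 1 +
          Finsupp.single (G.b p) 1) ((1 : ℤˣ) : ℤ) = 0 - X (G.c p) * X (G.d p) := by
        have : monomial (Finsupp.single (G.a p) 1 + Finsupp.single (G.b p) 1) ((1 : ℤˣ) : ℤ) =
            X (G.a p) * X (G.b p) := by
          rw [X, X, monomial_mul]
          simp
        rw [this]
        simp only [quadric, Sum.elim_inl]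
        ring
      simp only [HasLeadingTerm, Sum.elim_inl, Sum.elim_inr, Pi.one_apply]
      rw [this]
      refine WeightLT.sub (fun γ hγ => by simp at hγ) (weightLT_X_mul_X ?_)
      rw [map_add, Finsupp.weight_single, one_smul, Finsupp.weight_single, one_smul]
      omega
    · have h1 := h2 p
      have he := hw (G.e p)
      have hf := hw (G.f p)
      have : G.quadric (Sum.inr p) - monomial (Finsupp.single (G.e p) 1) ((1 : ℤˣ) : ℤ) =
          0 - X (G.f p) := by
        simp only [quadric, Sum.elim_inr]
        rw [Units.val_one, ← X]
        ring
      simp only [HasLeadingTerm, Sum.elim_inr, Pi.one_apply]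
      rw [this]
      refine WeightLT.sub (fun γ hγ => by simp at hγ) (weightLT_X ?_)
      rw [Finsupp.weight_single, one_smul]
      omega
  · rintro (p | p | p) <;> simp
  · refine pairwise_disjoint_of_label G.out_injective
      (Sum.elim (Sum.elim (fun p => Sum.inr (Sum.inl p)) fun p => Sum.inr (Sum.inl p))
        (Sum.elim (fun p => Sum.inr (Sum.inr p)) Sum.inl)) _ ?_
    rintro (x | p | p) s hs
    · refine ⟨Sum.inr (Sum.inr x), ?_, rfl⟩
      simpa [Finsupp.single_apply] using hs
    · have := Finsupp.support_add hs
      rcases Finset.mem_union.1 this with hs | hs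
      · refine ⟨Sum.inl (Sum.inl p), ?_, rfl⟩
        simpa [Finsupp.single_apply] using hs
      · refine ⟨Sum.inl (Sum.inr p), ?_, rfl⟩
        simpa [Finsupp.single_apply] using hs
    · refine ⟨Sum.inr (Sum.inl p), ?_, rfl⟩
      simpa [Finsupp.single_apply] using hs

end BraidData

/-! ### Flatness, regular sequence and vanishing of Tor -/

namespace BraidData

variable {σ V₄ V₂ : Type} {r : σ → σ → Prop} (G : BraidData σ V₄ V₂ r)

/-- Setting the gluing variables of B to zero turns B into P and R' into the glued ring, so the
freeness of `free_gluing_quadric` passes down as flatness. -/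
theorem flat_quot_rename [Fintype V₄] [Fintype V₂] [Fintype {x : σ × σ // r x.1 x.2}]
    [Algebra (MvPolynomial (V₄ ⊕ V₂) ℤ) (MvPolynomial (Quot r) ℤ)]
    (h : ∀ v, algebraMap (MvPolynomial (V₄ ⊕ V₂) ℤ) (MvPolynomial (Quot r) ℤ) (X v) =
      rename (Quot.mk r) (G.quadric v)) :
    Module.Flat (MvPolynomial (V₄ ⊕ V₂) ℤ) (MvPolynomial (Quot r) ℤ) := by
  let B := MvPolynomial ({x : σ × σ // r x.1 x.2} ⊕ (V₄ ⊕ V₂)) ℤ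
  let iBP : Algebra B (MvPolynomial (V₄ ⊕ V₂) ℤ) := (aeval (Sum.elim (fun _ => 0) X)).toAlgebra
  let iBR' : Algebra B (MvPolynomial σ ℤ) := (aeval (Sum.elim G.gluing G.quadric)).toAlgebra
  let iR : Algebra (MvPolynomial σ ℤ) (MvPolynomial (Quot r) ℤ) :=
    (rename (Quot.mk r)).toAlgebra
  let iBR : Algebra B (MvPolynomial (Quot r) ℤ) :=
    ((algebraMap (MvPolynomial σ ℤ) (MvPolynomial (Quot r) ℤ)).comp
      (algebraMap B (MvPolynomial σ ℤ))).toAlgebra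
  have hBP (i) : algebraMap B (MvPolynomial (V₄ ⊕ V₂) ℤ) (X i) =
      Sum.elim (fun _ => (0 : MvPolynomial (V₄ ⊕ V₂) ℤ)) X i := aeval_X _ _
  have hBR' (i) : algebraMap B (MvPolynomial σ ℤ) (X i) = Sum.elim G.gluing G.quadric i :=
    aeval_X _ _
  have hR (x) : algebraMap (MvPolynomial σ ℤ) (MvPolynomial (Quot r) ℤ) x =
    rename (Quot.mk r) x := rfl
  have := G.free_gluing_quadric hBR'
  have t1 : IsScalarTower B (MvPolynomial σ ℤ) (MvPolynomial (Quot r) ℤ) :=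
    IsScalarTower.of_algebraMap_eq fun _ => rfl
  have hg (x) : rename (Quot.mk r) (G.gluing x) = 0 := by
    rw [gluing, map_sub, rename_X, rename_X, Quot.sound x.2, sub_self]
  have t2 : IsScalarTower B (MvPolynomial (V₄ ⊕ V₂) ℤ) (MvPolynomial (Quot r) ℤ) := by
    refine IsScalarTower.of_algebraMap_eq' (ringHom_ext (fun n => by simp) ?_)
    rintro (x | v)
    · rw [RingHom.comp_apply, hBP, IsScalarTower.algebraMap_apply B (MvPolynomial σ ℤ), hBR', hR]
      simp [hg]
    · rw [RingHom.comp_apply, hBP, IsScalarTower.algebraMap_apply B (MvPolynomial σ ℤ), hBR', hR]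
      simp [h]
  refine flat_of_surjective_of_ker (B := B) (R' := MvPolynomial σ ℤ) ?_ ?_ ?_
  · intro p
    refine ⟨rename Sum.inr p, ?_⟩
    change aeval _ _ = _
    rw [aeval_rename, Sum.elim_comp_inr, aeval_X_left_apply]
  · exact rename_surjective _ Quot.mk_surjective
  · refine (ker_rename_quot r).trans_le (Ideal.span_le.2 ?_)
    rintro _ ⟨x, rfl⟩
    refine Set.mem_of_eq_of_mem (hBR' (Sum.inl x)).symm (Ideal.mem_map_of_mem _ ?_)
    rw [RingHom.mem_ker, hBP]
    rfl

/-- Here the variables set to zero are those of the linear relations. The reduced quadrics give the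
same P-algebra structure as the quadrics because they agree modulo `openL`. -/
theorem flat_quot_openL [Fintype V₄] [Fintype V₂]
    [Algebra (MvPolynomial (V₄ ⊕ V₂) ℤ) (MvPolynomial σ ℤ)]
    (h : ∀ v, algebraMap (MvPolynomial (V₄ ⊕ V₂) ℤ) (MvPolynomial σ ℤ) (X v) = G.quadric v) :
    Module.Flat (MvPolynomial (V₄ ⊕ V₂) ℤ) (MvPolynomial σ ℤ ⧸ G.openL) := by
  let B := MvPolynomial (V₄ ⊕ (V₄ ⊕ V₂)) ℤ
  let iBP : Algebra B (MvPolynomial (V₄ ⊕ V₂) ℤ) := (aeval (Sum.elim (fun _ => 0) X)).toAlgebra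
  let iBR' : Algebra B (MvPolynomial σ ℤ) :=
    (aeval (Sum.elim G.linear G.reducedQuadric)).toAlgebra
  have hBP (i) : algebraMap B (MvPolynomial (V₄ ⊕ V₂) ℤ) (X i) =
      Sum.elim (fun _ => (0 : MvPolynomial (V₄ ⊕ V₂) ℤ)) X i := aeval_X _ _
  have hBR' (i) : algebraMap B (MvPolynomial σ ℤ) (X i) = Sum.elim G.linear G.reducedQuadric i :=
    aeval_X _ _
  have := G.free_linear_reducedQuadric hBR'
  have t2 : IsScalarTower B (MvPolynomial (V₄ ⊕ V₂) ℤ) (MvPolynomial σ ℤ ⧸ G.openL) := by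
    refine IsScalarTower.of_algebraMap_eq' (R := B) (S := MvPolynomial (V₄ ⊕ V₂) ℤ)
      (A := MvPolynomial σ ℤ ⧸ G.openL) (ringHom_ext (fun n => by simp) ?_)
    rintro (p | v)
    · rw [RingHom.comp_apply, hBP, IsScalarTower.algebraMap_apply B (MvPolynomial σ ℤ), hBR']
      simp only [Sum.elim_inl, map_zero]
      exact Ideal.Quotient.eq_zero_iff_mem.2 (Ideal.subset_span ⟨p, rfl⟩)
    · rw [RingHom.comp_apply, hBP, IsScalarTower.algebraMap_apply B (MvPolynomial σ ℤ), hBR',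
        Sum.elim_inr, Sum.elim_inr,
        IsScalarTower.algebraMap_apply (MvPolynomial (V₄ ⊕ V₂) ℤ) (MvPolynomial σ ℤ), h]
      exact (Ideal.Quotient.eq.2 (G.quadric_sub_reducedQuadric_mem v)).symm
  refine flat_of_surjective_of_ker (B := B) (R' := MvPolynomial σ ℤ) ?_ ?_ ?_
  · intro p
    refine ⟨rename Sum.inr p, ?_⟩
    change aeval _ _ = _
    rw [aeval_rename, Sum.elim_comp_inr, aeval_X_left_apply]
  · exact Ideal.Quotient.mk_surjective
  · refine (Ideal.mk_ker (I := G.openL)).trans_le (Ideal.span_le.2 ?_)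
    rintro _ ⟨x, rfl⟩
    refine Set.mem_of_eq_of_mem (hBR' (Sum.inl x)).symm (Ideal.mem_map_of_mem _ ?_)
    rw [RingHom.mem_ker, hBP]
    rfl

theorem mem_of_gluing_mul_mem (s : Finset {x : σ × σ // r x.1 x.2}) (j : {x : σ × σ // r x.1 x.2})
    (hj : j ∉ s) (x : MvPolynomial σ ℤ)
    (hx : G.gluing j * x ∈ G.openL ⊔ Ideal.span (G.gluing '' s)) :
    x ∈ G.openL ⊔ Ideal.span (G.gluing '' s) := by
  classical
  -- The translation X_t ↦ X_t + w(t)T changes a relation by T times the net flow of w, hence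
  -- changes only the gluing at j.
  obtain ⟨w, -, h4, -, hr⟩ := G.exists_flow 0 0 (Pi.single j 1)
  let τ : MvPolynomial σ ℤ →+* Polynomial (MvPolynomial σ ℤ) :=
    eval₂Hom (Int.castRingHom _) fun t => Polynomial.C (X t) + (w t : Polynomial _) * Polynomial.X
  have hτ (t : σ) : τ (X t) = Polynomial.C (X t) + (w t : Polynomial _) * Polynomial.X :=
    eval₂Hom_X' _ _ _
  have hglue (y) : τ (G.gluing y) = ((Pi.single j 1 : _ → ℤ) y : Polynomial _) * Polynomial.X +
      Polynomial.C (G.gluing y) := by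
    rw [gluing, map_sub, hτ, hτ, map_sub, ← hr y]
    push_cast
    ring
  refine Ideal.mem_of_mul_mem_of_translation _ (G.gluing j) τ ?_ ?_ ?_ hx
  · intro x
    have : (Polynomial.evalRingHom 0).comp τ = RingHom.id _ :=
      ringHom_ext (by simp) (by simp [hτ])
    exact RingHom.congr_fun this x
  · rw [sup_le_iff, openL, Ideal.span_le, Ideal.span_le]
    constructor
    · rintro _ ⟨p, rfl⟩
      have hL : τ (G.linear p) = Polynomial.C (G.linear p) := by
        have h0 : ((w (G.a p) + w (G.b p) - w (G.c p) - w (G.d p) : ℤ) :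
            Polynomial (MvPolynomial σ ℤ)) = 0 := by
          rw [h4]
          simp
        push_cast at h0
        simp only [linear, map_add, map_sub, hτ]
        linear_combination Polynomial.X * h0
      rw [SetLike.mem_coe, Ideal.mem_comap, hL]
      exact Ideal.mem_map_of_mem _ (Ideal.mem_sup_left (Ideal.subset_span ⟨p, rfl⟩))
    · rintro _ ⟨y, hy, rfl⟩
      have hyj : y ≠ j := fun h => hj (h ▸ hy)
      rw [SetLike.mem_coe, Ideal.mem_comap, hglue, Pi.single_eq_of_ne hyj, Int.cast_zero,
        zero_mul, zero_add]
      exact Ideal.mem_map_of_mem _ (Ideal.mem_sup_right (Ideal.subset_span ⟨y, hy, rfl⟩))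
  · rw [hglue, Pi.single_eq_same, Int.cast_one, one_mul]

theorem isZero_tor [Fintype V₄] [Fintype V₂] [Fintype {x : σ × σ // r x.1 x.2}] {i : ℕ}
    (hi : Fintype.card {x : σ × σ // r x.1 x.2} < i) {L Q : Ideal (MvPolynomial (Quot r) ℤ)}
    (hL : L = G.openL.map (rename (Quot.mk r)))
    (hQ : Q = (Ideal.span (Set.range G.quadric)).map (rename (Quot.mk r))) :
    Limits.IsZero (((Tor (ModuleCat.{0} (MvPolynomial (Quot r) ℤ)) i).obj
      (ModuleCat.of _ (MvPolynomial (Quot r) ℤ ⧸ L))).obj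
        (ModuleCat.of _ (MvPolynomial (Quot r) ℤ ⧸ Q))) := by
  let P := MvPolynomial (V₄ ⊕ V₂) ℤ
  let iR' : Algebra P (MvPolynomial σ ℤ) := (aeval G.quadric).toAlgebra
  let iR : Algebra P (MvPolynomial (Quot r) ℤ) :=
    ((rename (Quot.mk r)).comp (aeval G.quadric)).toAlgebra
  have h1 (v) : algebraMap P (MvPolynomial σ ℤ) (X v) = G.quadric v := aeval_X _ _
  have h2 (v) : algebraMap P (MvPolynomial (Quot r) ℤ) (X v) =
      rename (Quot.mk r) (G.quadric v) := congrArg (rename (Quot.mk r)) (h1 v)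
  have := G.flat_quot_rename h2
  have := G.flat_quot_openL h1
  -- P/I is ℤ with all vertex variables acting by zero, so its base change to the glued ring is the
  -- quotient by Q.
  let I : Ideal P := Ideal.span (Set.range X)
  let F : ProjectiveResolution (ModuleCat.of P (P ⧸ I)) := ProjectiveResolution.of _
  have hE := exactAbove_quotient_sup_span (P := P) G.openL G.gluing G.mem_of_gluing_mul_mem F
    Finset.univ
  have hmap : I.map (algebraMap P (MvPolynomial (Quot r) ℤ)) = Q := by
    rw [hQ, Ideal.map_span, Ideal.map_span, ← Set.range_comp, ← Set.range_comp]
    congr 2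
    funext v
    exact h2 v
  let φ : MvPolynomial σ ℤ →ₐ[P] MvPolynomial (Quot r) ℤ :=
    { (rename (Quot.mk r)).toRingHom with commutes' := fun _ => rfl }
  have hφ : Function.Surjective φ := rename_surjective _ Quot.mk_surjective
  let ψ : MvPolynomial σ ℤ →ₐ[P] MvPolynomial (Quot r) ℤ ⧸ L := (Ideal.Quotient.mkₐ P L).comp φ
  have hψ : Function.Surjective ψ := Ideal.Quotient.mk_surjective.comp hφ
  have hker : RingHom.ker ψ = G.openL ⊔
      Ideal.span (G.gluing '' ((Finset.univ : Finset {x : σ × σ // r x.1 x.2}) : Set _)) := by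
    have : RingHom.ker ψ = L.comap φ := by
      ext x
      exact Ideal.Quotient.eq_zero_iff_mem
    rw [this, hL]
    refine (Ideal.comap_map_of_surjective (rename (Quot.mk r)).toRingHom hφ _).trans ?_
    rw [Finset.coe_univ, Set.image_univ]
    congr 1
    exact ker_rename_quot r
  refine isZero_tor_of_exactAbove F (hE.of_equiv ((Ideal.quotientEquivAlgOfEq P hker.symm).trans
    (Ideal.quotientKerAlgEquivOfSurjective hψ)).toLinearEquiv) (by rwa [Finset.card_univ]) ?_
  exact ((Ideal.quotientEquivAlgOfEq (MvPolynomial (Quot r) ℤ) hmap.symm).trans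
    (Algebra.TensorProduct.quotIdealMapEquivTensorQuot (MvPolynomial (Quot r) ℤ)
      I)).symm.toLinearEquiv

end BraidData

/-! ### Segments, strands and vertices of a braid graph -/

namespace OpenPartialBraidGraph

variable (Γ : OpenPartialBraidGraph)

theorem strictMonoOn_height (i : Fin Γ.n) : StrictMonoOn (fun t => (Γ.arc i t).2) (Icc 0 1) := by
  refine strictMonoOn_of_deriv_pos (convex_Icc 0 1) (Γ.smooth i).continuousOn.snd fun t ht => ?_
  rw [interior_Icc] at ht
  rw [← derivWithin_of_mem_nhds (Icc_mem_nhds ht.1 ht.2)]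
  exact Γ.deriv_pos i t (Ioo_subset_Icc_self ht)

theorem injOn_arc (i : Fin Γ.n) : InjOn (Γ.arc i) (Icc 0 1) := fun _ hs _ ht h =>
  (Γ.strictMonoOn_height i).injOn hs ht (congrArg Prod.snd h)

variable {Γ}

theorem mem_Ioo_of_arc_mem {i : Fin Γ.n} {t : ℝ} (ht : t ∈ Icc (0 : ℝ) 1) (h : Γ.arc i t ∈ Γ.W) :
    t ∈ Ioo (0 : ℝ) 1 := by
  obtain ⟨j, s, hs, hst⟩ := Γ.vertex_mem _ h
  by_cases hij : j = i
  · subst hij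
    rwa [← Γ.injOn_arc j (Ioo_subset_Icc_self hs) ht hst]
  · exact (Γ.meet_interior j i hij s (Ioo_subset_Icc_self hs) t ht hst).2

theorem idx_eq_of_endpoint {i j : Fin Γ.n} {s t : ℝ} (hs : s = 0 ∨ s = 1)
    (ht : t ∈ Icc (0 : ℝ) 1) (h : Γ.arc i s = Γ.arc j t) : i = j := by
  by_contra hij
  have hs' : s ∈ Icc (0 : ℝ) 1 := by
    rcases hs with rfl | rfl <;> simp
  have := (Γ.meet_interior i j hij s hs' t ht h).1
  rcases hs with rfl | rfl <;> simp at this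

theorem finite_vertexTimes (i : Fin Γ.n) : {t | t ∈ Icc (0 : ℝ) 1 ∧ Γ.arc i t ∈ Γ.W}.Finite :=
  Set.Finite.of_finite_image (f := Γ.arc i) (Γ.W.finite_toSet.subset (by
    rintro _ ⟨t, ht, rfl⟩
    exact ht.2)) fun _ hs _ ht h => Γ.injOn_arc i hs.1 ht.1 h

namespace Segment

theorem lo_mem (s : Γ.Segment) : s.lo ∈ Icc (0 : ℝ) 1 :=
  ⟨s.zero_le_lo, s.lo_lt_hi.le.trans s.hi_le_one⟩

theorem hi_mem (s : Γ.Segment) : s.hi ∈ Icc (0 : ℝ) 1 :=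
  ⟨s.zero_le_lo.trans s.lo_lt_hi.le, s.hi_le_one⟩

theorem ext_of_eq {s t : Γ.Segment} (h : s.idx = t.idx) (hlo : s.lo = t.lo) (hhi : s.hi = t.hi) :
    s = t := by
  cases s
  cases t
  simp only at h hlo hhi
  subst h hlo hhi
  rfl

theorem hi_le_of_lo_eq {s t : Γ.Segment} (h : s.idx = t.idx) (hlo : s.lo = t.lo) : s.hi ≤ t.hi := by
  by_contra! hlt
  rcases t.hi_end with h1 | h1
  · exact absurd s.hi_le_one (by rw [← h1]; exact not_le.2 hlt)
  · refine s.no_vertex t.hi ⟨?_, hlt⟩ (h ▸ h1)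
    rw [hlo]
    exact t.lo_lt_hi

theorem ext_of_lo {s t : Γ.Segment} (h : s.idx = t.idx) (hlo : s.lo = t.lo) : s = t :=
  ext_of_eq h hlo (le_antisymm (hi_le_of_lo_eq h hlo) (hi_le_of_lo_eq h.symm hlo.symm))

theorem lo_le_of_hi_eq {s t : Γ.Segment} (h : s.idx = t.idx) (hhi : s.hi = t.hi) : s.lo ≤ t.lo := by
  by_contra! hlt
  rcases s.lo_end with h1 | h1
  · exact absurd t.zero_le_lo (by rw [← h1]; exact not_le.2 hlt)
  · refine t.no_vertex s.lo ⟨hlt, ?_⟩ (h ▸ h1)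
    rw [← hhi]
    exact s.lo_lt_hi

theorem ext_of_hi {s t : Γ.Segment} (h : s.idx = t.idx) (hhi : s.hi = t.hi) : s = t :=
  ext_of_eq h (le_antisymm (lo_le_of_hi_eq h hhi) (lo_le_of_hi_eq h.symm hhi.symm)) hhi

/-- The segment runs to the next of the finitely many vertex times on the arc, or to 1 if there is
none. -/
theorem exists_lo_eq {i : Fin Γ.n} {t : ℝ} (ht : t ∈ Ico (0 : ℝ) 1)
    (h : t = 0 ∨ Γ.arc i t ∈ Γ.W) : ∃ s : Γ.Segment, s.idx = i ∧ s.lo = t := by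
  have hfin : ({1} ∪ {u | u ∈ Icc (0 : ℝ) 1 ∧ Γ.arc i u ∈ Γ.W} ∩ Ioi t).Finite :=
    (Set.finite_singleton _).union ((finite_vertexTimes i).inter_of_left _)
  obtain ⟨u, hu, hmin⟩ := Set.exists_min_image _ id hfin ⟨1, Or.inl rfl⟩
  have hu1 : u ≤ 1 := hmin 1 (Or.inl rfl)
  have htu : t < u := by
    rcases hu with rfl | hu
    · exact ht.2
    · exact hu.2
  refine ⟨⟨i, t, u, ht.1, htu, hu1, h, ?_, ?_⟩, rfl, rfl⟩
  · rcases hu with hu | hu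
    · exact Or.inl hu
    · exact Or.inr hu.1.2
  · intro v hv hW
    exact absurd (hmin v (Or.inr ⟨⟨⟨ht.1.trans hv.1.le, hv.2.le.trans hu1⟩, hW⟩, hv.1⟩))
      (not_le.2 hv.2)

theorem exists_hi_eq {i : Fin Γ.n} {t : ℝ} (ht : t ∈ Ioc (0 : ℝ) 1)
    (h : t = 1 ∨ Γ.arc i t ∈ Γ.W) : ∃ s : Γ.Segment, s.idx = i ∧ s.hi = t := by
  have hfin : ({0} ∪ {u | u ∈ Icc (0 : ℝ) 1 ∧ Γ.arc i u ∈ Γ.W} ∩ Iio t).Finite :=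
    (Set.finite_singleton _).union ((finite_vertexTimes i).inter_of_left _)
  obtain ⟨u, hu, hmax⟩ := Set.exists_max_image _ id hfin ⟨0, Or.inl rfl⟩
  have hu0 : 0 ≤ u := hmax 0 (Or.inl rfl)
  have hut : u < t := by
    rcases hu with rfl | hu
    · exact ht.1
    · exact hu.2
  refine ⟨⟨i, u, t, hu0, hut, ht.2, ?_, h, ?_⟩, rfl, rfl⟩
  · rcases hu with hu | hu
    · exact Or.inl hu
    · exact Or.inr hu.1.2
  · intro v hv hW
    exact absurd (hmax v (Or.inr ⟨⟨⟨hu0.trans hv.1.le, hv.2.le.trans ht.2⟩, hW⟩, hv.2⟩))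
      (not_le.2 hv.1)

theorem lo_ne_zero {s : Γ.Segment} (h : s.initial ∈ Γ.W) : s.lo ≠ 0 :=
  (mem_Ioo_of_arc_mem s.lo_mem h).1.ne'

theorem hi_ne_one {s : Γ.Segment} (h : s.final ∈ Γ.W) : s.hi ≠ 1 :=
  (mem_Ioo_of_arc_mem s.hi_mem h).2.ne

theorem ext_of_initial {s t : Γ.Segment} (h : s.idx = t.idx) (hi : s.initial = t.initial) :
    s = t := by
  refine ext_of_lo h (Γ.injOn_arc s.idx s.lo_mem t.lo_mem ?_)
  exact Eq.trans hi (by rw [h, initial])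

theorem ext_of_final {s t : Γ.Segment} (h : s.idx = t.idx) (hi : s.final = t.final) :
    s = t := by
  refine ext_of_hi h (Γ.injOn_arc s.idx s.hi_mem t.hi_mem ?_)
  exact Eq.trans hi (by rw [h, final])

theorem height_initial_lt_final (s : Γ.Segment) : s.initial.2 < s.final.2 :=
  Γ.strictMonoOn_height s.idx s.lo_mem s.hi_mem s.lo_lt_hi

theorem exists_initial_eq {i : Fin Γ.n} {p : ℝ × ℝ} (hp : p ∈ Γ.W) (h : p ∈ Γ.arc i '' Icc 0 1) :
    ∃ s : Γ.Segment, s.idx = i ∧ s.initial = p := by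
  obtain ⟨t, ht, rfl⟩ := h
  obtain ⟨s, rfl, rfl⟩ := exists_lo_eq (Ioo_subset_Ico_self (mem_Ioo_of_arc_mem ht hp)) (Or.inr hp)
  exact ⟨s, rfl, rfl⟩

theorem exists_final_eq {i : Fin Γ.n} {p : ℝ × ℝ} (hp : p ∈ Γ.W) (h : p ∈ Γ.arc i '' Icc 0 1) :
    ∃ s : Γ.Segment, s.idx = i ∧ s.final = p := by
  obtain ⟨t, ht, rfl⟩ := h
  obtain ⟨s, rfl, rfl⟩ := exists_hi_eq (Ioo_subset_Ioc_self (mem_Ioo_of_arc_mem ht hp)) (Or.inr hp)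
  exact ⟨s, rfl, rfl⟩

/-- The arc of s is counted to the left of x but not to the left of its own end. Thus the rank
determines the end point, which makes `Joined` a partial injection. -/
theorem topRank_lt {s : Γ.Segment} (h1 : s.hi = 1) (h2 : s.final.2 = 1) {x : ℝ}
    (hx : s.final.1 < x) : Γ.topRank s.final.1 < Γ.topRank x := by
  refine Set.ncard_lt_ncard ⟨fun i hi => ⟨hi.1, hi.2.trans hx⟩, fun hsub => ?_⟩ (Set.toFinite _)
  rw [final, h1] at h2 hx
  have := (hsub (show s.idx ∈ _ from ⟨h2, hx⟩)).2
  rw [final, h1] at this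
  exact lt_irrefl _ this

theorem bottomRank_lt {s : Γ.Segment} (h1 : s.lo = 0) (h2 : s.initial.2 = 0) {x : ℝ}
    (hx : s.initial.1 < x) : Γ.bottomRank s.initial.1 < Γ.bottomRank x := by
  refine Set.ncard_lt_ncard ⟨fun i hi => ⟨hi.1, hi.2.trans hx⟩, fun hsub => ?_⟩ (Set.toFinite _)
  rw [initial, h1] at h2 hx
  have := (hsub (show s.idx ∈ _ from ⟨h2, hx⟩)).2
  rw [initial, h1] at this
  exact lt_irrefl _ this

theorem Joined.left_unique {s s' t : Γ.Segment} (h : s.Joined t) (h' : s'.Joined t) : s = s' := by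
  obtain ⟨h1, h2, -, -, h3⟩ := h
  obtain ⟨h1', h2', -, -, h3'⟩ := h'
  have hx : s.final.1 = s'.final.1 := by
    rcases lt_trichotomy s.final.1 s'.final.1 with hlt | heq | hlt
    · exact absurd (topRank_lt h1 h2 hlt) (by omega)
    · exact heq
    · exact absurd (topRank_lt h1' h2' hlt) (by omega)
  have hf : s.final = s'.final := Prod.ext hx (h2.trans h2'.symm)
  exact ext_of_final (idx_eq_of_endpoint (Or.inr h1) s'.hi_mem hf) hf

theorem Joined.right_unique {s t t' : Γ.Segment} (h : s.Joined t) (h' : s.Joined t') : t = t' := by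
  obtain ⟨-, -, h1, h2, h3⟩ := h
  obtain ⟨-, -, h1', h2', h3'⟩ := h'
  have hx : t.initial.1 = t'.initial.1 := by
    rcases lt_trichotomy t.initial.1 t'.initial.1 with hlt | heq | hlt
    · exact absurd (bottomRank_lt h1 h2 hlt) (by omega)
    · exact heq
    · exact absurd (bottomRank_lt h1' h2' hlt) (by omega)
  have hf : t.initial = t'.initial := Prod.ext hx (h2.trans h2'.symm)
  exact ext_of_initial (idx_eq_of_endpoint (Or.inl h1) t'.lo_mem hf) hf

end Segment

/-- The strands of the braid closure. -/
abbrev Strand (Γ : OpenPartialBraidGraph) : Type :=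
  {x : Γ.Segment × Γ.Segment // x.1.Joined x.2}

/-- The arc of `Γ` that starts at the end of a strand. -/
def Strand.arc (x : Γ.Strand) : {i | (Γ.arc i 0).2 = 0} :=
  ⟨x.1.2.idx, by
    obtain ⟨-, -, h1, h2, -⟩ := x.2
    rwa [Segment.initial, h1] at h2⟩

theorem Strand.arc_injective : Function.Injective (Strand.arc (Γ := Γ)) := by
  rintro ⟨⟨s, t⟩, h⟩ ⟨⟨s', t'⟩, h'⟩ heq
  have h1 : t.idx = t'.idx := congrArg Subtype.val heq
  have h2 : t = t' := Segment.ext_of_lo h1 (h.2.2.1.trans h'.2.2.1.symm)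
  simp only at h h'
  subst h2
  obtain rfl := h.left_unique h'
  rfl

instance : Finite Γ.Strand := Finite.of_injective _ Strand.arc_injective

theorem card_strand_le : Nat.card Γ.Strand ≤ Γ.numStrands := by
  rw [numStrands, ← Nat.card_coe_set_eq]
  exact Nat.card_le_card_of_injective _ Strand.arc_injective

theorem IsFourValent.exists_segments {p : ℝ × ℝ} (hp : Γ.IsFourValent p) :
    ∃ a b c d : Γ.Segment, a ≠ b ∧ c ≠ d ∧ a.initial = p ∧ b.initial = p ∧ c.final = p ∧
      d.final = p ∧ (∀ s : Γ.Segment, s.initial = p → s = a ∨ s = b) ∧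
      ∀ s : Γ.Segment, s.final = p → s = c ∨ s = d := by
  obtain ⟨hW, i, j, hij, hi, hj⟩ := hp
  have hidx (l : Fin Γ.n) (hl : p ∈ Γ.arc l '' Icc 0 1) : l = i ∨ l = j := by
    by_contra! hne
    have := Γ.no_triple i j l hij hne.1.symm hne.2.symm
    exact Set.eq_empty_iff_forall_notMem.1 this p ⟨⟨hi, hj⟩, hl⟩
  obtain ⟨a, rfl, ha⟩ := Segment.exists_initial_eq hW hi
  obtain ⟨b, rfl, hb⟩ := Segment.exists_initial_eq hW hj
  obtain ⟨c, hci, hc⟩ := Segment.exists_final_eq hW hi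
  obtain ⟨d, hdi, hd⟩ := Segment.exists_final_eq hW hj
  refine ⟨a, b, c, d, fun h => hij (h ▸ rfl), fun h => hij (hci ▸ hdi ▸ h ▸ rfl), ha, hb, hc, hd,
    fun s hs => ?_, fun s hs => ?_⟩
  · exact (hidx s.idx ⟨s.lo, s.lo_mem, hs⟩).imp
      (fun h => Segment.ext_of_initial h (hs.trans ha.symm))
      fun h => Segment.ext_of_initial h (hs.trans hb.symm)
  · exact (hidx s.idx ⟨s.hi, s.hi_mem, hs⟩).imp
      (fun h => Segment.ext_of_final (h.trans hci.symm) (hs.trans hc.symm))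
      fun h => Segment.ext_of_final (h.trans hdi.symm) (hs.trans hd.symm)

theorem IsTwoValent.exists_segments {p : ℝ × ℝ} (hp : Γ.IsTwoValent p) :
    ∃ e f : Γ.Segment, e.initial = p ∧ f.final = p ∧ (∀ s : Γ.Segment, s.initial = p → s = e) ∧
      ∀ s : Γ.Segment, s.final = p → s = f := by
  obtain ⟨hW, i, hi, huniq⟩ := hp
  obtain ⟨e, hei, he⟩ := Segment.exists_initial_eq hW hi
  obtain ⟨f, hfi, hf⟩ := Segment.exists_final_eq hW hi
  refine ⟨e, f, he, hf, fun s hs => ?_, fun s hs => ?_⟩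
  · exact Segment.ext_of_initial ((huniq s.idx ⟨s.lo, s.lo_mem, hs⟩).trans hei.symm)
      (hs.trans he.symm)
  · exact Segment.ext_of_final ((huniq s.idx ⟨s.hi, s.hi_mem, hs⟩).trans hfi.symm)
      (hs.trans hf.symm)

theorem isFourValent_or_isTwoValent {p : ℝ × ℝ} (hp : p ∈ Γ.W) :
    Γ.IsFourValent p ∨ Γ.IsTwoValent p := by
  obtain ⟨i, t, ht, hit⟩ := Γ.vertex_mem p hp
  have hi : p ∈ Γ.arc i '' Icc 0 1 := ⟨t, Ioo_subset_Icc_self ht, hit⟩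
  by_cases h : ∃ j, i ≠ j ∧ p ∈ Γ.arc j '' Icc 0 1
  · obtain ⟨j, hij, hj⟩ := h
    exact Or.inl ⟨hp, i, j, hij, hi, hj⟩
  · refine Or.inr ⟨hp, i, hi, fun j hj => ?_⟩
    by_contra hne
    exact h ⟨j, Ne.symm hne, hj⟩

theorem IsFourValent.not_isTwoValent {p : ℝ × ℝ} (h : Γ.IsFourValent p) : ¬ Γ.IsTwoValent p := by
  obtain ⟨-, i, j, hij, hi, hj⟩ := h
  rintro ⟨-, l, -, hl⟩
  exact hij ((hl i hi).trans (hl j hj).symm)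

end OpenPartialBraidGraph

/-! ### Nodes, heights and flows on the closure -/

namespace OpenPartialBraidGraph

variable {Γ : OpenPartialBraidGraph}

variable (Γ) in
/-- The vertices of the graph obtained by subdividing each strand of the closure once. -/
abbrev Node : Type := {p // Γ.IsFourValent p} ⊕ {p // Γ.IsTwoValent p} ⊕ Γ.Strand

instance : Finite {p // Γ.IsFourValent p} :=
  Set.Finite.to_subtype (s := {p | Γ.IsFourValent p}) (Γ.W.finite_toSet.subset fun _ h => h.1)

instance : Finite {p // Γ.IsTwoValent p} :=
  Set.Finite.to_subtype (s := {p | Γ.IsTwoValent p}) (Γ.W.finite_toSet.subset fun _ h => h.1)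

namespace Segment

/-- The segment `s` starts at the node `v`. -/
def StartsAt (s : Γ.Segment) : Γ.Node → Prop :=
  Sum.elim (fun p => s.initial = p.1) (Sum.elim (fun p => s.initial = p.1) fun x => x.1.2 = s)

/-- The segment `s` ends at the node `v`. -/
def EndsAt (s : Γ.Segment) : Γ.Node → Prop :=
  Sum.elim (fun p => s.final = p.1) (Sum.elim (fun p => s.final = p.1) fun x => x.1.1 = s)

theorem initial_notMem_of_joined {s t : Γ.Segment} (h : s.Joined t) : t.initial ∉ Γ.W :=
  fun hW => lo_ne_zero hW h.2.2.1

theorem final_notMem_of_joined {s t : Γ.Segment} (h : s.Joined t) : s.final ∉ Γ.W :=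
  fun hW => hi_ne_one hW h.1

theorem exists_node {p : ℝ × ℝ} (hp : p ∈ Γ.W) : ∃ v : Γ.Node, ∀ s : Γ.Segment,
    (s.initial = p → s.StartsAt v) ∧ (s.final = p → s.EndsAt v) := by
  rcases isFourValent_or_isTwoValent hp with h | h
  · exact ⟨Sum.inl ⟨p, h⟩, fun s => ⟨id, id⟩⟩
  · exact ⟨Sum.inr (Sum.inl ⟨p, h⟩), fun s => ⟨id, id⟩⟩

theorem StartsAt.unique {s : Γ.Segment} {v v' : Γ.Node} (h : s.StartsAt v) (h' : s.StartsAt v') :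
    v = v' := by
  have hJ (x : Γ.Strand) (p : ℝ × ℝ) (hp : p ∈ Γ.W) (h1 : s.initial = p) (h2 : x.1.2 = s) :
      False := by
    subst h2 h1
    exact initial_notMem_of_joined x.2 hp
  rcases v with p | p | x <;> rcases v' with p' | p' | x' <;>
    simp only [StartsAt, Sum.elim_inl, Sum.elim_inr] at h h'
  · rw [Subtype.ext (h.symm.trans h')]
  · exact absurd (h.symm.trans h' ▸ p'.2) p.2.not_isTwoValent
  · exact (hJ x' p p.2.1 h h').elim
  · exact absurd (h'.symm.trans h ▸ p.2) p'.2.not_isTwoValent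
  · rw [Subtype.ext (h.symm.trans h')]
  · exact (hJ x' p p.2.1 h h').elim
  · exact (hJ x p' p'.2.1 h' h).elim
  · exact (hJ x p' p'.2.1 h' h).elim
  · have h1 := x.2
    have h2 := x'.2
    rw [h] at h1
    rw [h'] at h2
    rw [Subtype.ext (Prod.ext (h1.left_unique h2) (h.trans h'.symm))]

theorem EndsAt.unique {s : Γ.Segment} {v v' : Γ.Node} (h : s.EndsAt v) (h' : s.EndsAt v') :
    v = v' := by
  have hJ (x : Γ.Strand) (p : ℝ × ℝ) (hp : p ∈ Γ.W) (h1 : s.final = p) (h2 : x.1.1 = s) :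
      False := by
    subst h2 h1
    exact final_notMem_of_joined x.2 hp
  rcases v with p | p | x <;> rcases v' with p' | p' | x' <;>
    simp only [EndsAt, Sum.elim_inl, Sum.elim_inr] at h h'
  · rw [Subtype.ext (h.symm.trans h')]
  · exact absurd (h.symm.trans h' ▸ p'.2) p.2.not_isTwoValent
  · exact (hJ x' p p.2.1 h h').elim
  · exact absurd (h'.symm.trans h ▸ p.2) p'.2.not_isTwoValent
  · rw [Subtype.ext (h.symm.trans h')]
  · exact (hJ x' p p.2.1 h h').elim
  · exact (hJ x p' p'.2.1 h' h).elim
  · exact (hJ x p' p'.2.1 h' h).elim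
  · have h1 := x.2
    have h2 := x'.2
    rw [h] at h1
    rw [h'] at h2
    rw [Subtype.ext (Prod.ext (h.trans h'.symm) (h1.right_unique h2))]

end Segment

noncomputable section

/-- The first outgoing segment at a four-valent vertex. -/
def outA (p : {p // Γ.IsFourValent p}) : Γ.Segment := p.2.exists_segments.choose

/-- The second outgoing segment at a four-valent vertex. -/
def outB (p : {p // Γ.IsFourValent p}) : Γ.Segment := p.2.exists_segments.choose_spec.choose

/-- The first incoming segment at a four-valent vertex. -/
def inC (p : {p // Γ.IsFourValent p}) : Γ.Segment :=
  p.2.exists_segments.choose_spec.choose_spec.choose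

/-- The second incoming segment at a four-valent vertex. -/
def inD (p : {p // Γ.IsFourValent p}) : Γ.Segment :=
  p.2.exists_segments.choose_spec.choose_spec.choose_spec.choose

theorem fourValent_spec (p : {p // Γ.IsFourValent p}) :
    outA p ≠ outB p ∧ inC p ≠ inD p ∧ (outA p).initial = p.1 ∧ (outB p).initial = p.1 ∧
      (inC p).final = p.1 ∧ (inD p).final = p.1 ∧
      (∀ s : Γ.Segment, s.initial = p.1 → s = outA p ∨ s = outB p) ∧
      ∀ s : Γ.Segment, s.final = p.1 → s = inC p ∨ s = inD p :=
  p.2.exists_segments.choose_spec.choose_spec.choose_spec.choose_spec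

/-- The outgoing segment at a two-valent vertex. -/
def outE (p : {p // Γ.IsTwoValent p}) : Γ.Segment := p.2.exists_segments.choose

/-- The incoming segment at a two-valent vertex. -/
def inF (p : {p // Γ.IsTwoValent p}) : Γ.Segment := p.2.exists_segments.choose_spec.choose

theorem twoValent_spec (p : {p // Γ.IsTwoValent p}) :
    (outE p).initial = p.1 ∧ (inF p).final = p.1 ∧
      (∀ s : Γ.Segment, s.initial = p.1 → s = outE p) ∧
      ∀ s : Γ.Segment, s.final = p.1 → s = inF p :=
  p.2.exists_segments.choose_spec.choose_spec

/-- A segment starts at no more than one node, and the two chosen outgoing segments at a four-valent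
vertex differ. -/
theorem out_injective : Function.Injective
    (Sum.elim (Sum.elim outA outB) (Sum.elim outE fun x : Γ.Strand => x.1.2)) := by
  have key (x) : (Sum.elim (Sum.elim outA outB) (Sum.elim outE fun x : Γ.Strand => x.1.2)
      x).StartsAt (Sum.elim (Sum.elim Sum.inl Sum.inl) Sum.inr x) := by
    rcases x with (p | p) | (p | x)
    · exact (fourValent_spec p).2.2.1
    · exact (fourValent_spec p).2.2.2.1
    · exact (twoValent_spec p).1
    · exact rfl
  intro x y h
  have hv := (key x).unique (h ▸ key y)
  rcases x with (p | p) | x <;> rcases y with (q | q) | y <;>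
    simp only [Sum.elim_inl, Sum.elim_inr, Sum.inl.injEq, Sum.inr.injEq, reduceCtorEq] at hv h
  · rw [hv]
  · subst hv
    exact absurd h (fourValent_spec p).1
  · subst hv
    exact absurd h.symm (fourValent_spec p).1
  · rw [hv]
  · rw [hv]

/-- The number of vertices that are not above the initial point of a segment. -/
def level (s : Γ.Segment) : ℕ := (Γ.W.filter fun q => q.2 ≤ s.initial.2).card

theorem level_lt {s t : Γ.Segment} (ht : t.initial ∈ Γ.W) (h : s.final = t.initial) :
    level s < level t := by
  have hlt := s.height_initial_lt_final
  rw [h] at hlt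
  refine Finset.card_lt_card (Finset.ssubset_iff_of_subset ?_ |>.2 ⟨t.initial, ?_, ?_⟩)
  · intro q hq
    rw [Finset.mem_filter] at hq ⊢
    exact ⟨hq.1, hq.2.trans hlt.le⟩
  · exact Finset.mem_filter.2 ⟨ht, le_rfl⟩
  · rw [Finset.mem_filter]
    exact fun h' => absurd h'.2 (not_le.2 hlt)

open scoped Classical in
/-- A height of segments that increases along the graph and separates the two outgoing segments
at a four-valent vertex. -/
def segmentHeight (s : Γ.Segment) : ℕ := 2 * level s + if s ∈ Set.range outA then 1 else 0

/-- Levels count double in the height, so a step up in level outweighs the extra 1 given to the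
segments `outA`. -/
theorem segmentHeight_lt {s t : Γ.Segment} (ht : t.initial ∈ Γ.W) (h : s.final = t.initial) :
    segmentHeight s < segmentHeight t := by
  have := level_lt ht h
  unfold segmentHeight
  split_ifs <;> omega

theorem segmentHeight_outB_lt (p : {p // Γ.IsFourValent p}) :
    segmentHeight (outB p) < segmentHeight (outA p) := by
  have hne : outB p ∉ Set.range outA := by
    rintro ⟨q, hq⟩
    have := @out_injective Γ (Sum.inl (Sum.inl q)) (Sum.inl (Sum.inr p)) hq
    simp at this
  rw [segmentHeight, segmentHeight, if_neg hne, if_pos ⟨p, rfl⟩, level, level,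
    (fourValent_spec p).2.2.1, (fourValent_spec p).2.2.2.1]
  omega

/-- The net flow `out - in` at the nodes of a function on the segments. -/
def netFlow (w : Γ.Segment → ℤ) : Γ.Node → ℤ :=
  Sum.elim (fun p => w (outA p) + w (outB p) - w (inC p) - w (inD p))
    (Sum.elim (fun p => w (outE p) - w (inF p)) fun x => w x.1.2 - w x.1.1)

variable (Γ) in
/-- The functions on the nodes that are net flows of bounded functions on the segments. -/
def flowGroup : AddSubgroup (Γ.Node → ℤ) where
  -- Boundedness takes the place of finiteness of the set of segments and provides the lower bound
  -- required in `exists_flow`.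
  carrier := {g | ∃ (w : Γ.Segment → ℤ) (N : ℤ), (∀ s, |w s| ≤ N) ∧ netFlow w = g}
  zero_mem' := ⟨0, 0, by simp, by
    funext v
    rcases v with p | p | x <;> simp [netFlow]⟩
  add_mem' := by
    rintro _ _ ⟨w, N, hw, rfl⟩ ⟨w', N', hw', rfl⟩
    refine ⟨w + w', N + N', fun s => (abs_add_le _ _).trans (add_le_add (hw s) (hw' s)), ?_⟩
    funext v
    rcases v with p | p | x <;> simp [netFlow] <;> ring
  neg_mem' := by
    rintro _ ⟨w, N, hw, rfl⟩
    refine ⟨-w, N, fun s => by simpa using hw s, ?_⟩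
    funext v
    rcases v with p | p | x <;> simp [netFlow] <;> ring

open scoped Classical in
/-- The indicator function of the node at which a segment starts. -/
def startVec (s : Γ.Segment) (v : Γ.Node) : ℤ := if s.StartsAt v then 1 else 0

open scoped Classical in
/-- The indicator function of the node at which a segment ends. -/
def endVec (s : Γ.Segment) (v : Γ.Node) : ℤ := if s.EndsAt v then 1 else 0

open scoped Classical in
theorem startVec_eq_single {s : Γ.Segment} {v : Γ.Node} (h : s.StartsAt v) :
    startVec s = Pi.single v 1 := by
  funext v'
  rw [startVec, Pi.single_apply]
  exact if_congr ⟨fun h' => h'.unique h, fun h' => h' ▸ h⟩ rfl rfl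

open scoped Classical in
theorem endVec_eq_single {s : Γ.Segment} {v : Γ.Node} (h : s.EndsAt v) :
    endVec s = Pi.single v 1 := by
  funext v'
  rw [endVec, Pi.single_apply]
  exact if_congr ⟨fun h' => h'.unique h, fun h' => h' ▸ h⟩ rfl rfl

open scoped Classical in
theorem netFlow_single (s : Γ.Segment) : netFlow (Pi.single s 1) = startVec s - endVec s := by
  funext v
  rw [Pi.sub_apply, startVec, endVec]
  rcases v with p | p | x <;>
    simp only [netFlow, Sum.elim_inl, Sum.elim_inr, Segment.StartsAt, Segment.EndsAt,
      Pi.single_apply]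
  · obtain ⟨hab, hcd, ha, hb, hc, hd, hout, hin⟩ := fourValent_spec p
    have h1 : (if outA p = s then (1 : ℤ) else 0) + (if outB p = s then 1 else 0) =
        if s.initial = p.1 then 1 else 0 := by
      by_cases h : s.initial = p.1
      · rcases hout s h with rfl | rfl
        · simp [h, hab.symm]
        · simp [h, hab]
      · rw [if_neg, if_neg, if_neg h, add_zero]
        · rintro rfl
          exact h hb
        · rintro rfl
          exact h ha
    have h2 : (if inC p = s then (1 : ℤ) else 0) + (if inD p = s then 1 else 0) =
        if s.final = p.1 then 1 else 0 := by
      by_cases h : s.final = p.1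
      · rcases hin s h with rfl | rfl
        · simp [h, hcd.symm]
        · simp [h, hcd]
      · rw [if_neg, if_neg, if_neg h, add_zero]
        · rintro rfl
          exact h hd
        · rintro rfl
          exact h hc
    rw [h1, sub_sub, h2]
    congr
  · obtain ⟨he, hf, hout, hin⟩ := twoValent_spec p
    have h1 : outE p = s ↔ s.initial = p.1 := ⟨fun h => h ▸ he, fun h => (hout s h).symm⟩
    have h2 : inF p = s ↔ s.final = p.1 := ⟨fun h => h ▸ hf, fun h => (hin s h).symm⟩
    simp only [h1, h2]
    congr
  · congr

theorem startVec_sub_endVec_mem (s : Γ.Segment) : startVec s - endVec s ∈ Γ.flowGroup := by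
  classical
  refine ⟨Pi.single s 1, 1, fun t => ?_, netFlow_single s⟩
  rw [Pi.single_apply]
  split_ifs <;> simp

/-- Surplus can be pushed along s: the two vectors differ by the net flow of the indicator function
of s. -/
theorem startVec_mem_iff (s : Γ.Segment) : startVec s ∈ Γ.flowGroup ↔ endVec s ∈ Γ.flowGroup := by
  have := startVec_sub_endVec_mem s
  constructor <;> intro h
  · simpa using sub_mem h this
  · simpa using add_mem this h

theorem startVec_mem_iff_single {s : Γ.Segment} {v : Γ.Node} [DecidableEq Γ.Node]
    (h : s.StartsAt v ∨ s.EndsAt v) :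
    startVec s ∈ Γ.flowGroup ↔ (Pi.single v 1 : Γ.Node → ℤ) ∈ Γ.flowGroup := by
  rcases h with h | h
  · rw [startVec_eq_single h]
    convert Iff.rfl
  · rw [startVec_mem_iff, endVec_eq_single h]
    convert Iff.rfl

theorem startVec_mem_iff_of_incident {s t : Γ.Segment} {v : Γ.Node}
    (h : s.StartsAt v ∨ s.EndsAt v) (h' : t.StartsAt v ∨ t.EndsAt v) :
    startVec s ∈ Γ.flowGroup ↔ startVec t ∈ Γ.flowGroup := by
  classical
  rw [startVec_mem_iff_single h, startVec_mem_iff_single h']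

/-- Segments glued by a strand are both incident to the node of that strand. -/
theorem startVec_mem_iff_of_edge_eq {s t : Γ.Segment} (h : s.edge = t.edge) :
    startVec s ∈ Γ.flowGroup ↔ startVec t ∈ Γ.flowGroup := by
  have := congrArg (Quot.lift (fun s : Γ.Segment => startVec s ∈ Γ.flowGroup) fun s t hst =>
    propext (startVec_mem_iff_of_incident (v := Sum.inr (Sum.inr ⟨(s, t), hst⟩))
      (Or.inr rfl) (Or.inl rfl))) h
  exact iff_of_eq this

/-- At a loose end the segment has no node, so its vector at that end is zero and lies in the group.
-/
theorem exists_startVec_mem (hloose : Γ.looseEnds.Nonempty) :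
    ∃ s : Γ.Segment, startVec s ∈ Γ.flowGroup := by
  obtain ⟨x, i, ⟨rfl, hx⟩ | ⟨rfl, hx⟩⟩ := hloose
  · obtain ⟨s, rfl, hs⟩ := Segment.exists_lo_eq (Γ := Γ) (i := i) (t := 0) (by simp) (Or.inl rfl)
    refine ⟨s, ?_⟩
    have : startVec s = 0 := by
      funext v
      refine if_neg ?_
      rcases v with p | p | x <;>
        simp only [Segment.StartsAt, Sum.elim_inl, Sum.elim_inr]
      · exact fun h => Segment.lo_ne_zero (h ▸ p.2.1) hs
      · exact fun h => Segment.lo_ne_zero (h ▸ p.2.1) hs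
      · rintro rfl
        have := x.2.2.2.2.1
        rw [Segment.initial, hs] at this
        exact hx this
    rw [this]
    exact zero_mem _
  · obtain ⟨s, rfl, hs⟩ := Segment.exists_hi_eq (Γ := Γ) (i := i) (t := 1) (by simp) (Or.inl rfl)
    refine ⟨s, ?_⟩
    have : endVec s = 0 := by
      funext v
      refine if_neg ?_
      rcases v with p | p | x <;>
        simp only [Segment.EndsAt, Sum.elim_inl, Sum.elim_inr]
      · exact fun h => Segment.hi_ne_one (h ▸ p.2.1) hs
      · exact fun h => Segment.hi_ne_one (h ▸ p.2.1) hs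
      · rintro rfl
        have := x.2.2.1
        rw [Segment.final, hs] at this
        exact hx this
    rw [startVec_mem_iff, this]
    exact zero_mem _

/-- Membership spreads from a loose end along chains of adjacent edges, since segments meeting at a
common node are in the same situation. -/
theorem startVec_mem (hconn : Γ.ConnectedClosure) (hloose : Γ.looseEnds.Nonempty)
    (s : Γ.Segment) : startVec s ∈ Γ.flowGroup := by
  obtain ⟨s₀, hs₀⟩ := exists_startVec_mem hloose
  have key (x y : Γ.Edge) (h : Γ.edgeGraph.Reachable x y) :
      ∀ s t : Γ.Segment, s.edge = x → t.edge = y →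
        (startVec s ∈ Γ.flowGroup ↔ startVec t ∈ Γ.flowGroup) := by
    rw [SimpleGraph.reachable_iff_reflTransGen] at h
    induction h with
    | refl => exact fun s t hs ht => startVec_mem_iff_of_edge_eq (hs.trans ht.symm)
    | @tail y z _ hyz ih =>
      have shared {y z : Γ.Edge} (h : ∃ e f : Γ.Segment, e.edge = y ∧ f.edge = z ∧
          ∃ p ∈ Γ.W, (e.initial = p ∨ e.final = p) ∧ (f.initial = p ∨ f.final = p)) :
          ∃ e f : Γ.Segment, e.edge = y ∧ f.edge = z ∧
            (startVec e ∈ Γ.flowGroup ↔ startVec f ∈ Γ.flowGroup) := by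
        obtain ⟨e, f, he, hf, p, hp, hep, hfp⟩ := h
        obtain ⟨v, hv⟩ := Segment.exists_node hp
        exact ⟨e, f, he, hf, startVec_mem_iff_of_incident
          (hep.imp (hv e).1 (hv e).2) (hfp.imp (hv f).1 (hv f).2)⟩
      intro s t hs ht
      rcases (SimpleGraph.fromRel_adj _ _ _).1 hyz with ⟨-, h | h⟩
      · obtain ⟨e, f, he, hf, hef⟩ := shared h
        exact (ih s e hs he).trans
          (hef.trans (startVec_mem_iff_of_edge_eq (hf.trans ht.symm)))
      · obtain ⟨f, e, hf, he, hef⟩ := shared h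
        exact (ih s e hs he).trans
          (hef.symm.trans (startVec_mem_iff_of_edge_eq (hf.trans ht.symm)))
  exact (key _ _ (hconn.preconnected s₀.edge s.edge) s₀ s rfl rfl).1 hs₀

/-- Some segment starts at every node, so all unit vectors are net flows, and they span because
there are finitely many nodes. -/
theorem flowGroup_eq_top (hconn : Γ.ConnectedClosure) (hloose : Γ.looseEnds.Nonempty)
    (g : Γ.Node → ℤ) : g ∈ Γ.flowGroup := by
  classical
  have := Fintype.ofFinite Γ.Node
  have hsingle (v : Γ.Node) : (Pi.single v 1 : Γ.Node → ℤ) ∈ Γ.flowGroup := by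
    have : ∃ s : Γ.Segment, s.StartsAt v := by
      rcases v with p | p | x
      · exact ⟨outA p, (fourValent_spec p).2.2.1⟩
      · exact ⟨outE p, (twoValent_spec p).1⟩
      · exact ⟨x.1.2, rfl⟩
    obtain ⟨s, hs⟩ := this
    exact (startVec_mem_iff_single (Or.inl hs)).1 (startVec_mem hconn hloose s)
  rw [← Finset.univ_sum_single g]
  refine sum_mem fun v _ => ?_
  have : (Pi.single v (g v) : Γ.Node → ℤ) = g v • Pi.single v 1 := by
    rw [← Pi.single_smul, smul_eq_mul, mul_one]
  rw [this]
  exact zsmul_mem (hsingle v) _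

/-! ### Comparison with the ideals L and Q, and conclusion -/

/-- The combinatorics of the braid closure of a connected graph with a loose end. -/
def braidData (hconn : Γ.ConnectedClosure) (hloose : Γ.looseEnds.Nonempty) :
    BraidData Γ.Segment {p // Γ.IsFourValent p} {p // Γ.IsTwoValent p} Segment.Joined where
  a := outA
  b := outB
  c := inC
  d := inD
  e := outE
  f := inF
  height := segmentHeight
  height_lt_a := segmentHeight_outB_lt
  height_c_lt p := by
    obtain ⟨-, -, -, hb, hc, -⟩ := fourValent_spec p
    exact segmentHeight_lt (hb ▸ p.2.1) (hc.trans hb.symm)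
  height_d_lt p := by
    obtain ⟨-, -, -, hb, -, hd, -⟩ := fourValent_spec p
    exact segmentHeight_lt (hb ▸ p.2.1) (hd.trans hb.symm)
  height_f_lt p := by
    obtain ⟨he, hf, -⟩ := twoValent_spec p
    exact segmentHeight_lt (he ▸ p.2.1) (hf.trans he.symm)
  out_injective := out_injective
  exists_flow g₄ g₂ g := by
    obtain ⟨w, N, hw, h⟩ := flowGroup_eq_top hconn hloose (Sum.elim g₄ (Sum.elim g₂ g))
    exact ⟨w, ⟨-N, fun s => (abs_le.1 (hw s)).1⟩, fun p => congrFun h (Sum.inl p),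
      fun p => congrFun h (Sum.inr (Sum.inl p)), fun x => congrFun h (Sum.inr (Sum.inr x))⟩

/-- The ideals allow either order of the two outgoing and of the two incoming segments, while the
combinatorial data fix one; the relations are symmetric. -/
theorem pair_eq_or_swap {α : Type} {P : α → Prop} {a b a' b' : α} (hP : ∀ s, P s → s = a ∨ s = b)
    (hne : a' ≠ b') (ha : P a') (hb : P b') : a' = a ∧ b' = b ∨ a' = b ∧ b' = a := by
  rcases hP a' ha with rfl | rfl <;> rcases hP b' hb with rfl | rfl
  · exact absurd rfl hne
  · exact Or.inl ⟨rfl, rfl⟩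
  · exact Or.inr ⟨rfl, rfl⟩
  · exact absurd rfl hne

variable (hconn : Γ.ConnectedClosure) (hloose : Γ.looseEnds.Nonempty)

theorem idealL_eq_map : Γ.idealL =
    (braidData hconn hloose).openL.map (MvPolynomial.rename (Quot.mk Segment.Joined)) := by
  rw [BraidData.openL, Ideal.map_span, ← Set.range_comp, idealL]
  congr 1
  ext x
  constructor
  · rintro ⟨p, hp, a, b, c, d, hab, hcd, ha, hb, hc, hd, rfl⟩
    obtain ⟨-, -, -, -, -, -, hout, hin⟩ := fourValent_spec ⟨p, hp⟩
    refine ⟨⟨p, hp⟩, ?_⟩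
    simp only [Function.comp_apply, BraidData.linear, map_add, map_sub, MvPolynomial.rename_X]
    change (outA ⟨p, hp⟩).U + (outB ⟨p, hp⟩).U - (inC ⟨p, hp⟩).U - (inD ⟨p, hp⟩).U = _
    rcases pair_eq_or_swap hout hab ha hb with ⟨rfl, rfl⟩ | ⟨rfl, rfl⟩ <;>
      rcases pair_eq_or_swap hin hcd hc hd with ⟨rfl, rfl⟩ | ⟨rfl, rfl⟩ <;> ring
  · rintro ⟨p, rfl⟩
    obtain ⟨hab, hcd, ha, hb, hc, hd, -⟩ := fourValent_spec p
    refine ⟨p.1, p.2, outA p, outB p, inC p, inD p, hab, hcd, ha, hb, hc, hd, ?_⟩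
    simp only [Function.comp_apply, BraidData.linear, map_add, map_sub, MvPolynomial.rename_X]
    rfl

theorem idealQ_eq_map : Γ.idealQ = (Ideal.span (Set.range (braidData hconn hloose).quadric)).map
    (MvPolynomial.rename (Quot.mk Segment.Joined)) := by
  rw [Ideal.map_span, ← Set.range_comp, BraidData.quadric, Sum.comp_elim, Set.Sum.elim_range,
    idealQ]
  congr 2
  · ext x
    constructor
    · rintro ⟨p, hp, a, b, c, d, hab, hcd, ha, hb, hc, hd, rfl⟩
      obtain ⟨-, -, -, -, -, -, hout, hin⟩ := fourValent_spec ⟨p, hp⟩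
      refine ⟨⟨p, hp⟩, ?_⟩
      simp only [Function.comp_apply, map_mul, map_sub, MvPolynomial.rename_X]
      change (outA ⟨p, hp⟩).U * (outB ⟨p, hp⟩).U - (inC ⟨p, hp⟩).U * (inD ⟨p, hp⟩).U = _
      rcases pair_eq_or_swap hout hab ha hb with ⟨rfl, rfl⟩ | ⟨rfl, rfl⟩ <;>
        rcases pair_eq_or_swap hin hcd hc hd with ⟨rfl, rfl⟩ | ⟨rfl, rfl⟩ <;> ring
    · rintro ⟨p, rfl⟩
      obtain ⟨hab, hcd, ha, hb, hc, hd, -⟩ := fourValent_spec p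
      refine ⟨p.1, p.2, outA p, outB p, inC p, inD p, hab, hcd, ha, hb, hc, hd, ?_⟩
      simp only [Function.comp_apply, map_mul, map_sub, MvPolynomial.rename_X]
      rfl
  · ext x
    constructor
    · rintro ⟨p, hp, e, f, he, hf, rfl⟩
      obtain ⟨-, -, hout, hin⟩ := twoValent_spec ⟨p, hp⟩
      refine ⟨⟨p, hp⟩, ?_⟩
      simp only [Function.comp_apply, map_sub, MvPolynomial.rename_X]
      rw [hout e he, hin f hf]
      rfl
    · rintro ⟨p, rfl⟩
      obtain ⟨he, hf, -⟩ := twoValent_spec p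
      refine ⟨p.1, p.2, outE p, inF p, he, hf, ?_⟩
      simp only [Function.comp_apply, map_sub, MvPolynomial.rename_X]
      rfl

end

end OpenPartialBraidGraph

theorem mainTheorem3 (Γ : OpenPartialBraidGraph) (hconn : Γ.ConnectedClosure)
    (hloose : Γ.looseEnds.Nonempty) (i : ℕ) (hi : Γ.numStrands < i) :
    Limits.IsZero
      (((Tor (ModuleCat.{0} Γ.EdgeRing) i).obj (ModuleCat.of Γ.EdgeRing (Γ.EdgeRing ⧸ Γ.idealL))).obj
        (ModuleCat.of Γ.EdgeRing (Γ.EdgeRing ⧸ Γ.idealQ))) := by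
  have := Fintype.ofFinite {p // Γ.IsFourValent p}
  have := Fintype.ofFinite {p // Γ.IsTwoValent p}
  have := Fintype.ofFinite Γ.Strand
  refine (OpenPartialBraidGraph.braidData hconn hloose).isZero_tor ?_
    (OpenPartialBraidGraph.idealL_eq_map hconn hloose)
    (OpenPartialBraidGraph.idealQ_eq_map hconn hloose)
  rw [← Nat.card_eq_fintype_card]
  exact OpenPartialBraidGraph.card_strand_le.trans_lt hi
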